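/- **Notation.** For $\rho\in[1,\infty)$ and a finite real sequence $x$ let $\|x\|_\rho=(\sum_i|x_i|^\rho)^{1/\rho}$, and let $\|x\|_\infty=\max_i|x_i|$. For $\rho\in[1,\infty]$ let $\rho^*\in[1,\infty]$ be the Hölder conjugate, $\frac1\rho+\frac1{\rho^*}=1$. For a real $m\times n$ matrix $X$ let $\|X\|_{\ell_p^n\to\ell_q^m}=\sup\{\|Xt\|_q:\ t\in\mathbb R^n,\ \|t\|_p\le1\}$. Let $(c_i^*)_{i\le k}$ be the nonincreasing rearrangement of $(|c_i|)_{i\le k}$. Let $\varphi_2(t)=\exp(2-2t^{-2})$ for $t>0$, $\varphi_2(0)=0$, and $\|(c_i)_i\|_{\varphi_2}=\inf\{t>0:\ \sum_i\varphi_2(|c_i|/t)\le1\}$. For $c\in\mathbb R^k$ and $\rho\in[1,\infty]$ put $$\Lambda_\rho(c)=\|(c_i^*)_{i\le e^\rho}\|_{\varphi_2}+\sqrt\rho\,\|(c_i^*)_{i>e^\rho}\|_\rho,$$ where for $\rho=\infty$ the second summand (over an empty set of indices) is $0$. The exponent $\frac{2s}{s-2}$, $s\in(2,\infty]$, is read as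 $2$ when $s=\infty$. Norms of empty sequences are $0$. **Theorem 3.1.** There is a universal constant $C>0$ such that for all $m,n$, all $p,q\in[1,\infty]$, all deterministic sequences $a=(a_i)_{i\le m}$, $b=(b_j)_{j\le n}$ of real numbers, and all independent standard Gaussian random variables $(g_{i,j})_{i\le m,j\le n}$, the norm $\|(a_ib_jg_{i,j})_{i\le m,j\le n}\|_{\ell_p^n\to\ell_q^m}$ is integrable and $$C^{-1}R\ \le\ \mathbb E\bigl\|(a_ib_jg_{i,j})_{i\le m,j\le n}\bigr\|_{\ell_p^n\to\ell_q^m}\ \le\ C\,R,$$ where $$R=\begin{cases} \|a\|_{\frac{2q^*}{q^*-2}}\|b\|_{p^*}+\|a\|_q\|b\|_{\frac{2p}{p-2}},& p^*<2,\ q<2,\\ \|a\|_{\frac{2q^*}{q^*-2}}\,\Lambda_{p^*}(b)+\|a\|_q\|b\|_\infty,& q<2\le p^*,\\ \|a\|_\infty\|b\|_{p^*}+\Lambda_q(a)\,\|b\|_{\frac{2p}{p-2}},& p^*<2\le q,\\ \|a\|_\infty\,\Lambda_{p^*}(b)+\Lambda_q(a)\,\|b\|_\infty,& 2\le p^*,\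 2\le q. \end{cases}$$ -/

import Mathlib

open MeasureTheory ProbabilityTheory
open scoped ENNReal

noncomputable section

/-- The `ℓ_ρ`-norm of a finite real sequence, for `ρ ∈ [1, ∞]`:
`(∑ |x i| ^ ρ) ^ (1 / ρ)` for finite `ρ` and `max |x i|` for `ρ = ∞` (and `0` for the empty
sequence). -/
def ellNorm {ι : Type*} [Fintype ι] (ρ : ℝ≥0∞) (x : ι → ℝ) : ℝ :=
  ‖WithLp.toLp ρ x‖

/-- The operator norm of a real `m × n` matrix from `ℓ_p^n` to `ℓ_q^m`: the supremum of
`‖X t‖_q` over the unit ball of `ℓ_p^n`. -/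
def opNormLpLq {m n : ℕ} (p q : ℝ≥0∞) (X : Matrix (Fin m) (Fin n) ℝ) : ℝ :=
  ⨆ t : {t : Fin n → ℝ // ellNorm p t ≤ 1}, ellNorm q (X.mulVec t.1)

/-- The function `φ_ρ(t) = exp (2 - 2 t ^ (-ρ))` for `t > 0`, with `φ_ρ(0) = 0`. -/
def orliczPhi (ρ t : ℝ) : ℝ :=
  if 0 < t then Real.exp (2 - 2 * t ^ (-ρ)) else 0

/-- The Luxemburg functional
`‖c‖_{φ_ρ} = inf {t > 0 : ∑ φ_ρ(|c i| / t) ≤ 1}` of a finite real sequence. -/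
def orliczNorm {ι : Type*} [Fintype ι] (ρ : ℝ) (c : ι → ℝ) : ℝ :=
  sInf {t : ℝ | 0 < t ∧ ∑ i, orliczPhi ρ (|c i| / t) ≤ 1}

/-- The nonincreasing rearrangement `c^*` of `(|c i|)`; its largest term has index `0`. -/
def decRearr {k : ℕ} (c : Fin k → ℝ) : Fin k → ℝ :=
  fun i => |c (Tuple.sort (fun j => -|c j|) i)|

/-- The set of those indices whose position `i + 1` (counted from `1`) is at most `e ^ ρ`;
all indices if `ρ = ∞`. -/
def headSet (k : ℕ) (ρ : ℝ≥0∞) : Set (Fin k) :=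
  {i | ρ = ∞ ∨ ((i : ℕ) : ℝ) + 1 ≤ Real.exp ρ.toReal}

/-- The quantity `‖(c_i^*)_{i ≤ e^ρ}‖_{φ_2} + √ρ ‖(c_i^*)_{i > e^ρ}‖_ρ`.
The two subsequences are extended by zeros, which changes neither functional. If `ρ = ∞`, the
second subsequence is empty, and the second summand is `0`. -/
def splitNorm {k : ℕ} (ρ : ℝ≥0∞) (c : Fin k → ℝ) : ℝ :=
  orliczNorm 2 ((headSet k ρ).indicator (decRearr c)) +
    Real.sqrt ρ.toReal * ellNorm ρ ((headSet k ρ)ᶜ.indicator (decRearr c))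

/-- The exponent `2 s / (s - 2)` for `s ∈ (2, ∞]`, which is `2` (the limit) for `s = ∞`. -/
def twoExp (s : ℝ≥0∞) : ℝ≥0∞ :=
  if s = ∞ then 2 else 2 * s / (s - 2)

/-- `C⁻¹ y ≤ x ≤ C y`. -/
def TwoSided (C x y : ℝ) : Prop :=
  C⁻¹ * y ≤ x ∧ x ≤ C * y

end

/-! The expected norm is the expected supremum of the Gaussian process `∑ a_i s_i b_j t_j g_ij` over
`s` in the unit ball of `ℓ_{q*}` and `t` in the unit ball of `ℓ_p`. Chevet's inequality decouples
the two balls: up to constants the expectation equals `sup_t ‖(b_j t_j)‖_2 · 𝔼 ‖(a_i g_i)‖_q + sup_s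
‖(a_i s_i)‖_2 · 𝔼 ‖(b_j g_j)‖_{p*}`. Both directions (`chevet_upper`, `chevet_lower_left`,
`chevet_lower_right`) are increment comparisons fed to `sudakov_fernique`. That inequality is proved
by rotating one process into the other and differentiating a log-sum-exp smoothing of the maximum;
Gaussian integration by parts gives the derivative its sign.

The two suprema are norms of diagonal operators into `ℓ_2`, computed by Hölder's inequality
(`sum_mul_sq_le_diagNorm`, `exists_diagNorm_le_sum`); they give `‖·‖_∞` or the exponent `twoExp`.

It remains to estimate `𝔼 ‖(c_i g_i)‖_ρ`. For `ρ < 2` it is comparable to `‖c‖_ρ`. For `ρ ≥ 2` the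
sorted sequence is cut at index `e^ρ`. On the head the `ℓ_ρ` norm is the maximum up to a factor `e`,
and the expected maximum is an Orlicz norm because Gaussian tails are of the form `exp (-u²)`. On
the tail the growth `√ρ` of Gaussian moments gives the upper bound. For the lower bound
(`tail_le_integral_ellNorm`) each entry is compared with the maximum of the preceding block of about
`e^ρ` variables: that maximum has mean at least of order `√ρ`, while the comparison costs only a
bounded factor. -/

/-- The standard Gaussian measure on `ι → ℝ`. -/
noncomputable abbrev stdGauss (ι : Type*) [Fintype ι] : Measure (ι → ℝ) :=
  Measure.pi fun _ => gaussianReal 0 1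

/-! ### Gaussian integration by parts on the line. -/

theorem hasDerivAt_gaussianPDFReal (x : ℝ) :
    HasDerivAt (gaussianPDFReal 0 1) (-x * gaussianPDFReal 0 1 x) x := by
  have h : gaussianPDFReal 0 1 = fun x => (Real.sqrt (2 * Real.pi * 1))⁻¹ * Real.exp (-x ^ 2 / 2) := by
    ext x; simp [gaussianPDFReal]
  rw [h]
  have h1 : HasDerivAt (fun x : ℝ => -x ^ 2 / 2) (-x) x := by
    refine HasDerivAt.congr_deriv (((hasDerivAt_pow 2 x).fun_neg).div_const 2) ?_
    push_cast; ring
  refine (h1.exp.const_mul ((Real.sqrt (2 * Real.pi * 1))⁻¹)).congr_deriv ?_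
  ring

theorem integrable_gaussianReal_iff {f : ℝ → ℝ} :
    Integrable f (gaussianReal 0 1) ↔ Integrable (fun x => gaussianPDFReal 0 1 x * f x) := by
  rw [gaussianReal_of_var_ne_zero 0 one_ne_zero,
    integrable_withDensity_iff_integrable_smul' (measurable_gaussianPDF 0 1)
      (by simp [gaussianPDF_lt_top])]
  simp [toReal_gaussianPDF]

theorem integrable_id_gaussian : Integrable (fun x : ℝ => x) (gaussianReal 0 1) :=
  (memLp_id_gaussianReal 1).integrable (by simp)

/-- Stein's identity in dimension one. -/
theorem stein_identity {f f' : ℝ → ℝ} {M : ℝ} (hf : ∀ x, HasDerivAt f (f' x) x)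
    (hfM : ∀ x, |f x| ≤ M) (hf'M : ∀ x, |f' x| ≤ M) (hf'c : Continuous f') :
    ∫ x, x * f x ∂(gaussianReal 0 1) = ∫ x, f' x ∂(gaussianReal 0 1) := by
  have hfc : Continuous f := continuous_iff_continuousAt.2 fun x => (hf x).continuousAt
  have i1 : Integrable (fun x => x * f x) (gaussianReal 0 1) :=
    integrable_id_gaussian.mul_bdd (c := M) hfc.aestronglyMeasurable (.of_forall hfM)
  have i2 : Integrable f' (gaussianReal 0 1) :=
    Integrable.of_bound hf'c.aestronglyMeasurable M (.of_forall hf'M)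
  have i3 : Integrable f (gaussianReal 0 1) :=
    Integrable.of_bound hfc.aestronglyMeasurable M (.of_forall hfM)
  rw [integrable_gaussianReal_iff] at i1 i2 i3
  rw [integral_gaussianReal_eq_integral_smul one_ne_zero,
    integral_gaussianReal_eq_integral_smul one_ne_zero]
  have := integral_mul_deriv_eq_deriv_mul_of_integrable (u := f) (u' := f')
    (v := gaussianPDFReal 0 1) (v' := fun x => -x * gaussianPDFReal 0 1 x) (fun x _ => hf x)
    (fun x _ => hasDerivAt_gaussianPDFReal x)
    (by refine i1.neg.congr (.of_forall fun x => ?_); simp; ring)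
    (by refine i2.congr (.of_forall fun x => ?_); simp; ring)
    (by refine i3.congr (.of_forall fun x => ?_); simp; ring)
  have e : ∫ x, gaussianPDFReal 0 1 x • (x * f x) =
      -∫ x, f x * (-x * gaussianPDFReal 0 1 x) := by
    rw [← integral_neg]; congr 1; ext x; simp; ring
  rw [e, this, neg_neg]
  congr 1; ext x; simp; ring

/-! ### Integration by parts in one coordinate of a Gaussian vector. -/

section Resampling
variable {ι : Type*} [Fintype ι]

/-- Resampling one coordinate preserves the law, so Fubini can isolate that coordinate while the
outer integral stays over the full index set. -/
theorem measurePreserving_update [DecidableEq ι] (i : ι) :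
    MeasurePreserving (fun z : (ι → ℝ) × ℝ => Function.update z.1 i z.2)
      ((stdGauss ι).prod (gaussianReal 0 1)) (stdGauss ι) := by
  have hm : Measurable (fun z : (ι → ℝ) × ℝ => Function.update z.1 i z.2) := by
    rw [measurable_pi_iff]
    intro j
    by_cases h : j = i
    · subst h; simpa using measurable_snd
    · simp only [Function.update_of_ne h]; fun_prop
  refine ⟨hm, ?_⟩
  symm
  refine Measure.pi_eq fun s hs => ?_
  rw [Measure.map_apply hm (MeasurableSet.univ_pi hs)]
  have : (fun z : (ι → ℝ) × ℝ => Function.update z.1 i z.2) ⁻¹' Set.univ.pi s =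
      (Set.univ.pi (Function.update s i Set.univ)) ×ˢ s i := by
    ext z
    simp only [Set.mem_preimage, Set.mem_univ_pi, Set.mem_prod]
    constructor
    · intro h
      refine ⟨fun j => ?_, by simpa using h i⟩
      by_cases hj : j = i
      · subst hj; simp
      · simpa [hj] using h j
    · rintro ⟨h1, h2⟩ j
      by_cases hj : j = i
      · subst hj; simpa using h2
      · simpa [hj] using h1 j
  rw [this, Measure.prod_prod, Measure.pi_pi, ← Finset.mul_prod_erase _ _ (Finset.mem_univ i),
    ← Finset.mul_prod_erase Finset.univ (fun j => gaussianReal 0 1 (s j)) (Finset.mem_univ i)]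
  simp only [Function.update_self, measure_univ, one_mul]
  rw [mul_comm]
  congr 1
  refine Finset.prod_congr rfl fun j hj => ?_
  rw [Function.update_of_ne (Finset.ne_of_mem_erase hj)]

theorem hasLaw_eval_stdGauss (i : ι) :
    HasLaw (fun x : ι → ℝ => x i) (gaussianReal 0 1) (stdGauss ι) where
  aemeasurable := (measurable_pi_apply i).aemeasurable
  map_eq := (measurePreserving_eval (fun _ : ι => gaussianReal 0 1) i).map_eq

theorem integrable_eval_stdGauss (i : ι) : Integrable (fun x : ι → ℝ => x i) (stdGauss ι) :=
  (measurePreserving_eval (fun _ : ι => gaussianReal 0 1) i).integrable_comp_of_integrable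
    integrable_id_gaussian

/-- Stein's identity in one coordinate of a standard Gaussian vector. -/
theorem stein_identity_pi [DecidableEq ι] (i : ι) {f f' : (ι → ℝ) → ℝ} {M : ℝ}
    (hf : ∀ x y, HasDerivAt (fun y => f (Function.update x i y)) (f' (Function.update x i y)) y)
    (hfc : Continuous f) (hf'c : Continuous f')
    (hfM : ∀ x, |f x| ≤ M) (hf'M : ∀ x, |f' x| ≤ M) :
    ∫ x, x i * f x ∂(stdGauss ι) = ∫ x, f' x ∂(stdGauss ι) := by
  have i1 : Integrable (fun x => x i * f x) (stdGauss ι) :=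
    (integrable_eval_stdGauss i).mul_bdd (c := M) hfc.aestronglyMeasurable (.of_forall hfM)
  have i2 : Integrable f' (stdGauss ι) :=
    Integrable.of_bound hf'c.aestronglyMeasurable M (.of_forall hf'M)
  have mp := measurePreserving_update i
  have key : ∀ h : (ι → ℝ) → ℝ, Integrable h (stdGauss ι) → ∫ x, h x ∂(stdGauss ι) =
      ∫ x, ∫ y, h (Function.update x i y) ∂(gaussianReal 0 1) ∂(stdGauss ι) := by
    intro h hh
    have e := integral_map mp.aemeasurable (f := h) (by rw [mp.map_eq]; exact hh.1)
    rw [mp.map_eq] at e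
    rw [e]
    exact integral_prod _ (mp.integrable_comp_of_integrable hh)
  rw [key _ i1, key _ i2]
  congr 1
  ext x
  have hu : Continuous fun y : ℝ => Function.update x i y := by fun_prop
  simpa using stein_identity (f := fun y => f (Function.update x i y)) (M := M) (hf x)
    (fun y => hfM _) (fun y => hf'M _) (hf'c.comp hu)

end Resampling

/-! ### Comparison of Gaussian maxima. -/

section SudakovFernique
variable {ι κ : Type*} [Fintype ι] [Fintype κ]

/-- The softmax weights `exp (z u) / ∑ v, exp (z v)`. -/
noncomputable def softmax (z : κ → ℝ) (u : κ) : ℝ := Real.exp (z u) / ∑ v, Real.exp (z v)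

theorem sum_exp_pos [Nonempty κ] (z : κ → ℝ) : 0 < ∑ v, Real.exp (z v) :=
  Finset.sum_pos (fun _ _ => Real.exp_pos _) Finset.univ_nonempty

theorem softmax_nonneg (z : κ → ℝ) (u : κ) : 0 ≤ softmax z u :=
  div_nonneg (Real.exp_pos _).le (Finset.sum_nonneg fun _ _ => (Real.exp_pos _).le)

theorem sum_softmax [Nonempty κ] (z : κ → ℝ) : ∑ u, softmax z u = 1 := by
  simp only [softmax, ← Finset.sum_div]
  exact div_self (sum_exp_pos z).ne'

theorem softmax_le_one [Nonempty κ] (z : κ → ℝ) (u : κ) : softmax z u ≤ 1 := by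
  rw [← sum_softmax z]
  exact Finset.single_le_sum (fun v _ => softmax_nonneg z v) (Finset.mem_univ u)

theorem continuous_softmax [Nonempty κ] (u : κ) : Continuous fun z : κ → ℝ => softmax z u := by
  unfold softmax
  exact Continuous.div (by fun_prop) (by fun_prop) fun z => (sum_exp_pos z).ne'

theorem hasDerivAt_sum_exp {z : ℝ → κ → ℝ} {z' : κ → ℝ} {t : ℝ}
    (hz : ∀ u, HasDerivAt (fun s => z s u) (z' u) t) :
    HasDerivAt (fun s => ∑ v, Real.exp (z s v)) (∑ v, Real.exp (z t v) * z' v) t :=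
  HasDerivAt.fun_sum fun v _ => (hz v).exp

theorem hasDerivAt_log_sum_exp [Nonempty κ] {z : ℝ → κ → ℝ} {z' : κ → ℝ} {t : ℝ}
    (hz : ∀ u, HasDerivAt (fun s => z s u) (z' u) t) :
    HasDerivAt (fun s => Real.log (∑ v, Real.exp (z s v))) (∑ v, softmax (z t) v * z' v) t := by
  refine ((hasDerivAt_sum_exp hz).log (sum_exp_pos _).ne').congr_deriv ?_
  rw [Finset.sum_div]
  refine Finset.sum_congr rfl fun v _ => ?_
  rw [softmax]; ring

theorem hasDerivAt_softmax [Nonempty κ] {z : ℝ → κ → ℝ} {z' : κ → ℝ} {t : ℝ}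
    (hz : ∀ u, HasDerivAt (fun s => z s u) (z' u) t) (u : κ) :
    HasDerivAt (fun s => softmax (z s) u)
      (softmax (z t) u * (z' u - ∑ v, softmax (z t) v * z' v)) t := by
  refine ((hz u).exp.div (hasDerivAt_sum_exp hz) (sum_exp_pos _).ne').congr_deriv ?_
  have h := (sum_exp_pos (z t)).ne'
  have e : ∑ v, softmax (z t) v * z' v =
      (∑ v, Real.exp (z t v) * z' v) / ∑ v, Real.exp (z t v) := by
    rw [Finset.sum_div]
    refine Finset.sum_congr rfl fun v _ => ?_
    rw [softmax]; ring
  rw [e, softmax]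
  field_simp

/-- Gaussian integration by parts for a linear form against a softmax weight of linear forms. -/
theorem integral_dotProduct_mul_softmax [Nonempty κ] (w : ι → ℝ) (Z : κ → ι → ℝ) (u : κ) :
    ∫ x, (w ⬝ᵥ x) * softmax (fun v => Z v ⬝ᵥ x) u ∂(stdGauss ι) =
      ∫ x, softmax (fun v => Z v ⬝ᵥ x) u *
        (w ⬝ᵥ Z u - ∑ v, softmax (fun v => Z v ⬝ᵥ x) v * (w ⬝ᵥ Z v)) ∂(stdGauss ι) := by
  classical
  have hZc : Continuous fun x : ι → ℝ => fun v => Z v ⬝ᵥ x := by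
    unfold dotProduct; fun_prop
  have hsc : ∀ v, Continuous fun x : ι → ℝ => softmax (fun v => Z v ⬝ᵥ x) v :=
    fun v => (continuous_softmax v).comp hZc
  set f' : ι → (ι → ℝ) → ℝ := fun i x => softmax (fun v => Z v ⬝ᵥ x) u *
    (Z u i - ∑ v, softmax (fun v => Z v ⬝ᵥ x) v * Z v i) with hf'
  have hf'c : ∀ i, Continuous (f' i) := fun i => by
    simp only [hf']
    exact (hsc u).mul (continuous_const.sub
      (continuous_finsetSum _ fun v _ => (hsc v).mul continuous_const))
  have hf'M : ∀ i x, |f' i x| ≤ |Z u i| + ∑ v, |Z v i| := fun i x => by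
    simp only [hf', abs_mul, abs_of_nonneg (softmax_nonneg _ u)]
    refine (mul_le_of_le_one_left (abs_nonneg _) (softmax_le_one _ _)).trans ?_
    refine (abs_sub _ _).trans (add_le_add le_rfl ?_)
    refine (Finset.abs_sum_le_sum_abs _ _).trans (Finset.sum_le_sum fun v _ => ?_)
    rw [abs_mul, abs_of_nonneg (softmax_nonneg _ v)]
    exact mul_le_of_le_one_left (abs_nonneg _) (softmax_le_one _ _)
  have stein : ∀ i, ∫ x, x i * softmax (fun v => Z v ⬝ᵥ x) u ∂(stdGauss ι) =
      ∫ x, f' i x ∂(stdGauss ι) := fun i => by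
    refine stein_identity_pi i (M := max 1 (|Z u i| + ∑ v, |Z v i|)) (fun x y => ?_) (hsc u)
      (hf'c i) (fun x => ?_) (fun x => (hf'M i x).trans (le_max_right _ _))
    · refine hasDerivAt_softmax (z := fun y v => Z v ⬝ᵥ Function.update x i y)
        (z' := fun v => Z v i) (fun v => ?_) u
      have : (fun y => Z v ⬝ᵥ Function.update x i y) =
          fun y => Z v i * y + ∑ j ∈ Finset.univ.erase i, Z v j * x j := by
        ext y
        rw [dotProduct, ← Finset.add_sum_erase _ _ (Finset.mem_univ i)]
        simp only [Function.update_self]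
        congr 1
        refine Finset.sum_congr rfl fun j hj => ?_
        rw [Function.update_of_ne (Finset.ne_of_mem_erase hj)]
      rw [this]
      simpa using ((hasDerivAt_id y).const_mul (Z v i)).add_const
        (∑ j ∈ Finset.univ.erase i, Z v j * x j)
    · rw [abs_of_nonneg (softmax_nonneg _ _)]
      exact (softmax_le_one _ _).trans (le_max_left _ _)
  have l : ∀ x : ι → ℝ, (w ⬝ᵥ x) * softmax (fun v => Z v ⬝ᵥ x) u =
      ∑ i, w i * (x i * softmax (fun v => Z v ⬝ᵥ x) u) := fun x => by
    simp only [dotProduct, Finset.sum_mul, mul_assoc]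
  have r : ∀ x : ι → ℝ, softmax (fun v => Z v ⬝ᵥ x) u *
        (w ⬝ᵥ Z u - ∑ v, softmax (fun v => Z v ⬝ᵥ x) v * (w ⬝ᵥ Z v)) =
      ∑ i, w i * f' i x := fun x => by
    simp only [hf']
    simp only [mul_left_comm (w _), mul_sub, ← Finset.mul_sum, Finset.sum_sub_distrib, dotProduct]
    simp only [Finset.mul_sum, mul_left_comm (w _)]
    congr 1
    rw [Finset.sum_comm]
  simp only [l, r]
  rw [integral_finsetSum, integral_finsetSum]
  · simp only [integral_const_mul, stein]
  · intro i _
    exact (Integrable.of_bound (hf'c i).aestronglyMeasurable _ (.of_forall (hf'M i))).const_mul _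
  · intro i _
    refine ((integrable_eval_stdGauss i).mul_bdd (c := 1) (hsc u).aestronglyMeasurable
      (.of_forall fun x => ?_)).const_mul _
    rw [Real.norm_eq_abs, abs_of_nonneg (softmax_nonneg _ _)]
    exact softmax_le_one _ _

theorem integrable_dotProduct (w : ι → ℝ) : Integrable (fun x => w ⬝ᵥ x) (stdGauss ι) :=
  integrable_finsetSum _ fun i _ => (integrable_eval_stdGauss i).const_mul _

/-- With `log_sum_exp_le`, this shows that log-sum-exp is the maximum up to an additive `log` of the
number of terms. -/
theorem le_log_sum_exp (z : κ → ℝ) (u : κ) : z u ≤ Real.log (∑ v, Real.exp (z v)) := by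
  rw [Real.le_log_iff_exp_le (lt_of_lt_of_le (Real.exp_pos (z u))
    (Finset.single_le_sum (fun v _ => (Real.exp_pos (z v)).le) (Finset.mem_univ u)))]
  exact Finset.single_le_sum (fun v _ => (Real.exp_pos (z v)).le) (Finset.mem_univ u)

theorem log_sum_exp_le [Nonempty κ] {z : κ → ℝ} {M : ℝ} (h : ∀ u, z u ≤ M) :
    Real.log (∑ v, Real.exp (z v)) ≤ M + Real.log (Fintype.card κ) := by
  have hc : (0 : ℝ) < Fintype.card κ := by exact_mod_cast Fintype.card_pos
  rw [Real.log_le_iff_le_exp (sum_exp_pos z), Real.exp_add, Real.exp_log hc]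
  calc ∑ v, Real.exp (z v) ≤ ∑ _v : κ, Real.exp M :=
        Finset.sum_le_sum fun v _ => Real.exp_le_exp.2 (h v)
    _ = _ := by simp [mul_comm]

theorem continuous_log_sum_exp [Nonempty κ] :
    Continuous fun z : κ → ℝ => Real.log (∑ v, Real.exp (z v)) :=
  Continuous.log (by fun_prop) fun z => (sum_exp_pos z).ne'

theorem integrable_log_sum_exp [Nonempty κ] (Z : κ → ι → ℝ) :
    Integrable (fun x => Real.log (∑ v, Real.exp (Z v ⬝ᵥ x))) (stdGauss ι) := by
  have hi : Integrable (fun x => (∑ v, |Z v ⬝ᵥ x|) + Real.log (Fintype.card κ)) (stdGauss ι) :=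
    (integrable_finsetSum _ fun v _ => (integrable_dotProduct (Z v)).abs).add
      (integrable_const _)
  refine hi.mono' ?_ (.of_forall fun x => ?_)
  · exact (continuous_log_sum_exp.comp (by unfold dotProduct; fun_prop :
      Continuous fun x : ι → ℝ => fun v => Z v ⬝ᵥ x)).aestronglyMeasurable
  · have hc : (0 : ℝ) ≤ Real.log (Fintype.card κ) :=
      Real.log_nonneg (by exact_mod_cast Fintype.card_pos)
    have hs : ∀ v, |Z v ⬝ᵥ x| ≤ ∑ v, |Z v ⬝ᵥ x| := fun v =>
      Finset.single_le_sum (fun v _ => abs_nonneg (Z v ⬝ᵥ x)) (Finset.mem_univ v)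
    obtain ⟨u⟩ := ‹Nonempty κ›
    rw [Real.norm_eq_abs, abs_le]
    constructor
    · have := le_log_sum_exp (fun v => Z v ⬝ᵥ x) u
      have := neg_abs_le (Z u ⬝ᵥ x)
      have := hs u
      linarith
    · have : Nonempty κ := ⟨u⟩
      exact log_sum_exp_le fun v => (le_abs_self _).trans (hs v)

/-- Symmetrization: because the weights sum to one, twice the sum in question is the average of `D u
u + D v v - D u v - D v u` under the product weights. -/
theorem sum_quadratic_nonneg (p : κ → ℝ) (hp : ∀ u, 0 ≤ p u) (hp1 : ∑ u, p u = 1)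
    (D : κ → κ → ℝ) (hD : ∀ u v, 0 ≤ D u u + D v v - D u v - D v u) :
    0 ≤ ∑ u, p u * (D u u - ∑ v, p v * D u v) := by
  have e : ∑ u, ∑ v, p u * p v * (D u u + D v v - D u v - D v u) =
      2 * ∑ u, p u * (D u u - ∑ v, p v * D u v) := by
    have a1 : ∑ u, ∑ v, p u * p v * D u u = ∑ u, p u * D u u := by
      refine Finset.sum_congr rfl fun u _ => ?_
      calc ∑ v, p u * p v * D u u = (∑ v, p v) * (p u * D u u) := by
            rw [Finset.sum_mul]; exact Finset.sum_congr rfl fun v _ => by ring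
        _ = _ := by rw [hp1, one_mul]
    have a2 : ∑ u, ∑ v, p u * p v * D v v = ∑ u, p u * D u u := by
      rw [← a1, Finset.sum_comm]
      exact Finset.sum_congr rfl fun v _ => Finset.sum_congr rfl fun u _ => by ring
    have a3 : ∑ u, ∑ v, p u * p v * D v u = ∑ u, ∑ v, p u * p v * D u v := by
      rw [Finset.sum_comm]
      exact Finset.sum_congr rfl fun v _ => Finset.sum_congr rfl fun u _ => by ring
    have a4 : ∑ u, p u * ∑ v, p v * D u v = ∑ u, ∑ v, p u * p v * D u v := by
      simp only [Finset.mul_sum, mul_assoc]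
    simp only [mul_sub, mul_add, Finset.sum_sub_distrib, Finset.sum_add_distrib, a1, a2, a3, a4]
    ring
  have : 0 ≤ ∑ u, ∑ v, p u * p v * (D u u + D v v - D u v - D v u) :=
    Finset.sum_nonneg fun u _ => Finset.sum_nonneg fun v _ =>
      mul_nonneg (mul_nonneg (hp u) (hp v)) (hD u v)
  linarith

/-- Monotonicity of the smooth maximum under comparison of increments. -/
theorem integral_log_sum_exp_mono [Nonempty κ] (A B : κ → ι → ℝ)
    (horth : ∀ u v, A u ⬝ᵥ B v = 0)
    (hinc : ∀ u v, (A u - A v) ⬝ᵥ (A u - A v) ≤ (B u - B v) ⬝ᵥ (B u - B v)) :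
    ∫ x, Real.log (∑ v, Real.exp (A v ⬝ᵥ x)) ∂(stdGauss ι) ≤
      ∫ x, Real.log (∑ v, Real.exp (B v ⬝ᵥ x)) ∂(stdGauss ι) := by
  -- The rotation `Z` moves `A` (at `0`) into `B` (at `π / 2`), and `W` is its derivative in `θ`.
  -- The derivative of the smoothed maximum along it is shown to be nonnegative.
  set Z : ℝ → κ → ι → ℝ := fun θ v => Real.cos θ • A v + Real.sin θ • B v with hZ
  set W : ℝ → κ → ι → ℝ := fun θ v => -Real.sin θ • A v + Real.cos θ • B v with hW
  set φ : ℝ → ℝ := fun θ => ∫ x, Real.log (∑ v, Real.exp (Z θ v ⬝ᵥ x)) ∂(stdGauss ι) with hφ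
  set φ' : ℝ → ℝ := fun θ =>
    ∫ x, ∑ v, softmax (fun v => Z θ v ⬝ᵥ x) v * (W θ v ⬝ᵥ x) ∂(stdGauss ι) with hφ'
  have hsc : ∀ θ v, Continuous fun x : ι → ℝ => softmax (fun v => Z θ v ⬝ᵥ x) v := fun θ v =>
    (continuous_softmax v).comp
      (by unfold dotProduct; fun_prop : Continuous fun x : ι → ℝ => fun v => Z θ v ⬝ᵥ x)
  have hwc : ∀ θ v, Continuous fun x : ι → ℝ => W θ v ⬝ᵥ x := fun θ v => by
    unfold dotProduct; fun_prop
  have hder : ∀ θ, HasDerivAt φ (φ' θ) θ := fun θ => by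
    refine (hasDerivAt_integral_of_dominated_loc_of_deriv_le (s := Set.univ)
      (F' := fun θ x => ∑ v, softmax (fun v => Z θ v ⬝ᵥ x) v * (W θ v ⬝ᵥ x))
      (bound := fun x => ∑ v, (|A v ⬝ᵥ x| + |B v ⬝ᵥ x|)) Filter.univ_mem
      (.of_forall fun θ => (integrable_log_sum_exp (Z θ)).1) (integrable_log_sum_exp (Z θ)) ?_
      (.of_forall fun x θ _ => ?_) ?_ (.of_forall fun x θ _ => ?_)).2
    · exact (continuous_finsetSum _ fun v _ => (hsc θ v).mul (hwc θ v)).aestronglyMeasurable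
    · refine (norm_sum_le _ _).trans (Finset.sum_le_sum fun v _ => ?_)
      rw [norm_mul, Real.norm_eq_abs, Real.norm_eq_abs, abs_of_nonneg (softmax_nonneg _ _)]
      refine (mul_le_of_le_one_left (abs_nonneg _) (softmax_le_one _ _)).trans ?_
      simp only [hW, add_dotProduct, smul_dotProduct, smul_eq_mul]
      refine (abs_add_le _ _).trans (add_le_add ?_ ?_)
      · rw [abs_mul, abs_neg]
        exact mul_le_of_le_one_left (abs_nonneg _) (Real.abs_sin_le_one θ)
      · rw [abs_mul]
        exact mul_le_of_le_one_left (abs_nonneg _) (Real.abs_cos_le_one θ)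
    · exact integrable_finsetSum _ fun v _ =>
        (integrable_dotProduct (A v)).abs.add (integrable_dotProduct (B v)).abs
    · refine hasDerivAt_log_sum_exp fun u => ?_
      simp only [hZ, hW, add_dotProduct, smul_dotProduct, smul_eq_mul]
      exact ((Real.hasDerivAt_cos θ).mul_const _).add ((Real.hasDerivAt_sin θ).mul_const _)
  have hφ'nn : ∀ θ ∈ Set.Ioo 0 (Real.pi / 2), 0 ≤ φ' θ := fun θ hθ => by
    have i1 : ∀ v, Integrable (fun x => softmax (fun v => Z θ v ⬝ᵥ x) v * (W θ v ⬝ᵥ x))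
        (stdGauss ι) := fun v => by
      refine (integrable_dotProduct (W θ v)).bdd_mul (c := 1) (hsc θ v).aestronglyMeasurable
        (.of_forall fun x => ?_)
      rw [Real.norm_eq_abs, abs_of_nonneg (softmax_nonneg _ _)]
      exact softmax_le_one _ _
    have i2 : ∀ v, Integrable (fun x => softmax (fun v => Z θ v ⬝ᵥ x) v *
        (W θ v ⬝ᵥ Z θ v - ∑ u, softmax (fun v => Z θ v ⬝ᵥ x) u * (W θ v ⬝ᵥ Z θ u)))
        (stdGauss ι) := fun v => by
      refine Integrable.of_bound ((hsc θ v).mul (continuous_const.sub (continuous_finsetSum _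
        fun u _ => (hsc θ u).mul continuous_const))).aestronglyMeasurable
        (|W θ v ⬝ᵥ Z θ v| + ∑ u, |W θ v ⬝ᵥ Z θ u|) (.of_forall fun x => ?_)
      rw [Real.norm_eq_abs, abs_mul, abs_of_nonneg (softmax_nonneg _ _)]
      refine (mul_le_of_le_one_left (abs_nonneg _) (softmax_le_one _ _)).trans ?_
      refine (abs_sub _ _).trans (add_le_add le_rfl ?_)
      refine (Finset.abs_sum_le_sum_abs _ _).trans (Finset.sum_le_sum fun u _ => ?_)
      rw [abs_mul, abs_of_nonneg (softmax_nonneg _ _)]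
      exact mul_le_of_le_one_left (abs_nonneg _) (softmax_le_one _ _)
    have e : φ' θ = ∫ x, ∑ v, softmax (fun v => Z θ v ⬝ᵥ x) v *
        (W θ v ⬝ᵥ Z θ v - ∑ u, softmax (fun v => Z θ v ⬝ᵥ x) u * (W θ v ⬝ᵥ Z θ u))
        ∂(stdGauss ι) := by
      simp only [hφ']
      rw [integral_finsetSum _ fun v _ => i1 v, integral_finsetSum _ fun v _ => i2 v]
      refine Finset.sum_congr rfl fun v _ => ?_
      rw [← integral_dotProduct_mul_softmax]
      simp only [mul_comm]
    rw [e]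
    refine integral_nonneg fun x => ?_
    refine sum_quadratic_nonneg _ (softmax_nonneg _) (sum_softmax _)
      (fun u v => W θ u ⬝ᵥ Z θ v) fun u v => ?_
    have horth' : ∀ u v, B u ⬝ᵥ A v = 0 := fun u v => by rw [dotProduct_comm, horth]
    have hinc' := hinc u v
    simp only [sub_dotProduct, dotProduct_sub] at hinc'
    -- The combination is `(W u - W v) ⬝ᵥ (Z u - Z v)`. By orthogonality it equals `sin θ cos θ`
    -- times the difference of the squared increments of `B` and `A`.
    simp only [hZ, hW, add_dotProduct, smul_dotProduct, dotProduct_add, dotProduct_smul,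
      smul_eq_mul, horth, horth']
    have hc := Real.cos_pos_of_mem_Ioo ⟨by linarith [hθ.1, Real.pi_pos], hθ.2⟩
    have hs := Real.sin_pos_of_pos_of_lt_pi hθ.1 (by linarith [hθ.2, Real.pi_pos])
    nlinarith [mul_nonneg (mul_nonneg hc.le hs.le) (sub_nonneg.2 hinc')]
  have hmono : MonotoneOn φ (Set.Icc 0 (Real.pi / 2)) := by
    refine monotoneOn_of_deriv_nonneg (convex_Icc _ _)
      (fun θ _ => (hder θ).continuousAt.continuousWithinAt)
      (fun θ _ => (hder θ).differentiableAt.differentiableWithinAt) fun θ hθ => ?_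
    rw [interior_Icc] at hθ
    rw [(hder θ).deriv]
    exact hφ'nn θ hθ
  have hpi : (0 : ℝ) ≤ Real.pi / 2 := by positivity
  simpa [hφ, hZ] using hmono (Set.left_mem_Icc.2 hpi) (Set.right_mem_Icc.2 hpi) hpi

/-- The Sudakov–Fernique inequality. The right-hand maximum is replaced by a majorant `F`, and the
left-hand one by a minorant of the form `f ≤ max`. -/
theorem sudakov_fernique [Nonempty κ] (A B : κ → ι → ℝ)
    (horth : ∀ u v, A u ⬝ᵥ B v = 0)
    (hinc : ∀ u v, (A u - A v) ⬝ᵥ (A u - A v) ≤ (B u - B v) ⬝ᵥ (B u - B v))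
    {f F : (ι → ℝ) → ℝ} (hf : Integrable f (stdGauss ι)) (hF : Integrable F (stdGauss ι))
    (hfA : ∀ x, ∃ u, f x ≤ A u ⬝ᵥ x) (hFB : ∀ x u, B u ⬝ᵥ x ≤ F x) :
    ∫ x, f x ∂(stdGauss ι) ≤ ∫ x, F x ∂(stdGauss ι) := by
  -- Scaling both processes by `β` scales the maxima by `β` but leaves the smoothing error `log
  -- (card κ)` unchanged.
  have key : ∀ β : ℝ, 0 < β → β * ∫ x, f x ∂(stdGauss ι) ≤
      β * ∫ x, F x ∂(stdGauss ι) + Real.log (Fintype.card κ) := fun β hβ => by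
    have h := integral_log_sum_exp_mono (fun u => β • A u) (fun u => β • B u)
      (fun u v => by simp [horth]) (fun u v => by
        simp only [← smul_sub, smul_dotProduct, dotProduct_smul, smul_eq_mul]
        have := hinc u v
        gcongr)
    have h1 : β * ∫ x, f x ∂(stdGauss ι) ≤
        ∫ x, Real.log (∑ v, Real.exp ((β • A v) ⬝ᵥ x)) ∂(stdGauss ι) := by
      rw [← integral_const_mul]
      refine integral_mono (hf.const_mul _) (integrable_log_sum_exp _) fun x => ?_
      obtain ⟨u, hu⟩ := hfA x
      refine le_trans ?_ (le_log_sum_exp _ u)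
      rw [smul_dotProduct, smul_eq_mul]
      gcongr
    have h2 : ∫ x, Real.log (∑ v, Real.exp ((β • B v) ⬝ᵥ x)) ∂(stdGauss ι) ≤
        β * ∫ x, F x ∂(stdGauss ι) + Real.log (Fintype.card κ) := by
      have : β * ∫ x, F x ∂(stdGauss ι) + Real.log (Fintype.card κ) =
          ∫ x, (β * F x + Real.log (Fintype.card κ)) ∂(stdGauss ι) := by
        rw [integral_add (hF.const_mul _) (integrable_const _), integral_const_mul]
        simp
      rw [this]
      refine integral_mono (integrable_log_sum_exp _)
        ((hF.const_mul _).add (integrable_const _)) fun x => ?_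
      refine log_sum_exp_le fun u => ?_
      rw [smul_dotProduct, smul_eq_mul]
      have := hFB x u
      gcongr
    exact h1.trans (h.trans h2)
  by_contra! hlt
  set d := ∫ x, f x ∂(stdGauss ι) - ∫ x, F x ∂(stdGauss ι) with hd
  have hd0 : 0 < d := sub_pos.2 hlt
  have hlog : (0 : ℝ) ≤ Real.log (Fintype.card κ) :=
    Real.log_nonneg (by exact_mod_cast Fintype.card_pos)
  -- This `β` makes `β * d` exceed the smoothing error by one, a contradiction.
  have := key ((Real.log (Fintype.card κ) + 1) / d) (by positivity)
  have e : (Real.log (Fintype.card κ) + 1) / d * d = Real.log (Fintype.card κ) + 1 :=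
    div_mul_cancel₀ _ hd0.ne'
  rw [← sub_nonneg] at this
  nlinarith

end SudakovFernique

/-! ### Elementary properties of the `ℓ_ρ` norm. -/

section EllNorm
variable {ι : Type*} [Fintype ι] {ρ r : ℝ≥0∞}

theorem ellNorm_top (x : ι → ℝ) : ellNorm ∞ x = ⨆ i, |x i| := by
  simp [ellNorm, PiLp.norm_eq_ciSup]

theorem ellNorm_eq_rpow (h : 0 < ρ.toReal) (x : ι → ℝ) :
    ellNorm ρ x = (∑ i, |x i| ^ ρ.toReal) ^ (1 / ρ.toReal) := by
  simp [ellNorm, PiLp.norm_eq_sum h]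

theorem ellNorm_nonneg (h : 1 ≤ ρ) (x : ι → ℝ) : 0 ≤ ellNorm ρ x := by
  have : Fact (1 ≤ ρ) := ⟨h⟩
  exact norm_nonneg _

theorem ellNorm_zero (h : 1 ≤ ρ) : ellNorm ρ (0 : ι → ℝ) = 0 := by
  have : Fact (1 ≤ ρ) := ⟨h⟩
  simp [ellNorm]

theorem ellNorm_add_le (h : 1 ≤ ρ) (x y : ι → ℝ) :
    ellNorm ρ (x + y) ≤ ellNorm ρ x + ellNorm ρ y := by
  have : Fact (1 ≤ ρ) := ⟨h⟩
  exact norm_add_le (WithLp.toLp ρ x) (WithLp.toLp ρ y)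

theorem ellNorm_smul (h : 1 ≤ ρ) (c : ℝ) (x : ι → ℝ) :
    ellNorm ρ (c • x) = |c| * ellNorm ρ x := by
  have : Fact (1 ≤ ρ) := ⟨h⟩
  exact norm_smul c (WithLp.toLp ρ x)

theorem abs_le_ellNorm (h : 1 ≤ ρ) (x : ι → ℝ) (i : ι) : |x i| ≤ ellNorm ρ x := by
  have : Fact (1 ≤ ρ) := ⟨h⟩
  exact PiLp.norm_apply_le (WithLp.toLp ρ x) i

theorem one_le_toReal (h : 1 ≤ ρ) (ht : ρ ≠ ∞) : 1 ≤ ρ.toReal := by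
  simpa using ENNReal.toReal_mono ht h

theorem ellNorm_mono (h : 1 ≤ ρ) {x y : ι → ℝ} (hxy : ∀ i, |x i| ≤ |y i|) :
    ellNorm ρ x ≤ ellNorm ρ y := by
  by_cases ht : ρ = ∞
  · subst ht
    rw [ellNorm_top]
    exact Real.iSup_le (fun i => (hxy i).trans (abs_le_ellNorm h y i)) (ellNorm_nonneg h y)
  · have h1 := one_le_toReal h ht
    have h0 : 0 < ρ.toReal := by linarith
    rw [ellNorm_eq_rpow h0, ellNorm_eq_rpow h0]
    refine Real.rpow_le_rpow (Finset.sum_nonneg fun i _ => by positivity) ?_ (by positivity)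
    exact Finset.sum_le_sum fun i _ => Real.rpow_le_rpow (abs_nonneg _) (hxy i) h0.le

theorem ellNorm_congr_abs (h : 1 ≤ ρ) {x y : ι → ℝ}
    (hxy : ∀ i, |x i| = |y i|) : ellNorm ρ x = ellNorm ρ y :=
  le_antisymm (ellNorm_mono h fun i => (hxy i).le) (ellNorm_mono h fun i => (hxy i).ge)

theorem sum_rpow_le_one (h : 1 ≤ ρ) (ht : ρ ≠ ∞) {x : ι → ℝ} :
    ellNorm ρ x ≤ 1 ↔ ∑ i, |x i| ^ ρ.toReal ≤ 1 := by
  have h0 : 0 < ρ.toReal := by linarith [one_le_toReal h ht]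
  have hn : 0 ≤ ∑ i, |x i| ^ ρ.toReal := Finset.sum_nonneg fun i _ => by positivity
  rw [ellNorm_eq_rpow h0]
  refine ⟨fun H => ?_, fun H => Real.rpow_le_one hn H (by positivity)⟩
  by_contra! hlt
  exact absurd H (not_le.2 (Real.one_lt_rpow hlt (by positivity)))

end EllNorm

/-! ### Hölder duality and finite norming sets. -/

section Duality
variable {ι : Type*} [Fintype ι] {ρ r : ℝ≥0∞}

theorem holderConjugate_cases (h : ρ.HolderConjugate r) :
    (ρ = 1 ∧ r = ∞) ∨ (ρ = ∞ ∧ r = 1) ∨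
      (ρ ≠ ∞ ∧ r ≠ ∞ ∧ ρ.toReal.HolderConjugate r.toReal) := by
  by_cases h1 : ρ = ∞
  · subst h1
    right; left
    exact ⟨rfl, ENNReal.HolderConjugate.unique ∞ r 1⟩
  by_cases h2 : r = ∞
  · subst h2
    left
    have := h.symm
    exact ⟨ENNReal.HolderConjugate.unique ∞ ρ 1, rfl⟩
  · right; right
    refine ⟨h1, h2, ?_⟩
    have a : 1 < ρ := by
      rcases (ENNReal.HolderConjugate.one_le ρ r).lt_or_eq with h' | h'
      · exact h'
      · subst h'; exact absurd (ENNReal.HolderConjugate.unique 1 r ∞) h2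
    have b : 1 < r := by
      rcases (ENNReal.HolderConjugate.one_le r ρ).lt_or_eq with h' | h'
      · exact h'
      · subst h'; exact absurd (ENNReal.HolderConjugate.unique 1 ρ ∞) h1
    rw [Real.holderConjugate_iff]
    refine ⟨by simpa using (ENNReal.toReal_lt_toReal (by simp) h1).2 a, ?_⟩
    have e := ENNReal.HolderConjugate.inv_add_inv_eq_one ρ r
    have := congrArg ENNReal.toReal e
    rw [ENNReal.toReal_add (by simp; rintro rfl; simp at a) (by simp; rintro rfl; simp at b)] at this
    simpa [ENNReal.toReal_inv] using this

/-- Hölder's inequality. -/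
theorem dotProduct_le_ellNorm_mul (h : ρ.HolderConjugate r) (x t : ι → ℝ) :
    x ⬝ᵥ t ≤ ellNorm ρ x * ellNorm r t := by
  have key : ∀ x t : ι → ℝ, x ⬝ᵥ t ≤ ellNorm ∞ x * ellNorm 1 t := fun x t => by
    rw [ellNorm_eq_rpow (ρ := 1) (by simp)]
    simp only [ENNReal.toReal_one, Real.rpow_one, div_one, Finset.mul_sum, dotProduct]
    refine Finset.sum_le_sum fun i _ => (le_abs_self _).trans ?_
    rw [abs_mul]
    exact mul_le_mul_of_nonneg_right (abs_le_ellNorm le_top x i) (abs_nonneg _)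
  rcases holderConjugate_cases h with ⟨rfl, rfl⟩ | ⟨rfl, rfl⟩ | ⟨h1, h2, h3⟩
  · rw [dotProduct_comm, mul_comm]; exact key t x
  · exact key x t
  · rw [ellNorm_eq_rpow h3.pos, ellNorm_eq_rpow h3.symm.pos]
    exact Real.inner_le_Lp_mul_Lq _ _ _ h3

theorem exists_abs_eq_ellNorm_top [Nonempty ι] (x : ι → ℝ) : ∃ i, |x i| = ellNorm ∞ x := by
  obtain ⟨i, hi⟩ := exists_eq_ciSup_of_finite (f := fun i => |x i|)
  exact ⟨i, by rw [ellNorm_top]; exact hi⟩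

theorem ellNorm_single [DecidableEq ι] (h : 1 ≤ ρ) (i : ι) (c : ℝ) :
    ellNorm ρ (Pi.single i c) = |c| := by
  have : Fact (1 ≤ ρ) := ⟨h⟩
  exact PiLp.norm_single ρ (fun _ => ℝ) i c

/-- The norm `ellNorm ρ x` is attained by a functional in the unit ball of the dual space. -/
theorem exists_dotProduct_eq_ellNorm (h : ρ.HolderConjugate r) (x : ι → ℝ) :
    ∃ t : ι → ℝ, ellNorm r t ≤ 1 ∧ x ⬝ᵥ t = ellNorm ρ x := by
  classical
  have hs : ∀ y : ℝ, y * (SignType.sign y : ℝ) = |y| := fun y => self_mul_sign y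
  have hsa : ∀ y : ℝ, |(SignType.sign y : ℝ)| ≤ 1 := fun y => by
    rcases lt_trichotomy y 0 with h | h | h <;> simp [h, sign_neg, sign_pos]
  rcases holderConjugate_cases h with ⟨rfl, rfl⟩ | ⟨rfl, rfl⟩ | ⟨h1, h2, h3⟩
  · refine ⟨fun i => SignType.sign (x i), ?_, ?_⟩
    · rw [ellNorm_top]
      exact Real.iSup_le (fun i => hsa _) zero_le_one
    · rw [ellNorm_eq_rpow (ρ := 1) (by simp)]
      simp [dotProduct, hs]
  · rcases isEmpty_or_nonempty ι with hι | hι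
    · refine ⟨0, by rw [ellNorm_zero le_rfl]; exact zero_le_one, ?_⟩
      simp [ellNorm_top]
    · obtain ⟨i, hi⟩ := exists_abs_eq_ellNorm_top x
      refine ⟨Pi.single i (SignType.sign (x i) : ℝ), ?_, ?_⟩
      · rw [ellNorm_single le_rfl]; exact hsa _
      · rw [dotProduct_single, hs, hi]
  -- The extremizer in Hölder's inequality for the absolute values; the signs of `x` are attached
  -- afterwards.
  · obtain ⟨g, hg, he⟩ := (NNReal.isGreatest_Lp Finset.univ (fun i => ‖x i‖₊) h3).1
    refine ⟨fun i => SignType.sign (x i) * g i, ?_, ?_⟩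
    · have h1r : 1 ≤ r := ENNReal.HolderConjugate.one_le r ρ
      rw [sum_rpow_le_one h1r h2]
      have : ∑ i, (g i : ℝ) ^ r.toReal ≤ 1 := by exact_mod_cast hg
      refine le_trans (Finset.sum_le_sum fun i _ => ?_) this
      refine Real.rpow_le_rpow (abs_nonneg _) ?_ h3.symm.pos.le
      rw [abs_mul, NNReal.abs_eq]
      exact mul_le_of_le_one_left (g i).2 (hsa _)
    · rw [ellNorm_eq_rpow h3.pos]
      have := congrArg (fun z : NNReal => (z : ℝ)) he
      push_cast at this
      simp only [Real.norm_eq_abs] at this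
      rw [← this]
      simp only [dotProduct, ← mul_assoc, hs]

/-- A finite subset of the unit ball of `ℓ_r` which norms `ℓ_ρ` up to a factor `2`. -/
theorem exists_finset_norming (h : ρ.HolderConjugate r) :
    ∃ S : Finset (ι → ℝ), S.Nonempty ∧ (∀ s ∈ S, ellNorm r s ≤ 1) ∧
      ∀ x : ι → ℝ, ∃ s ∈ S, ellNorm ρ x ≤ 2 * (x ⬝ᵥ s) := by
  classical
  have h1r : 1 ≤ r := ENNReal.HolderConjugate.one_le r ρ
  have h1ρ : 1 ≤ ρ := ENNReal.HolderConjugate.one_le ρ r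
  have : Fact (1 ≤ r) := ⟨h1r⟩
  -- A finite `1/2`-net of the compact dual ball. Moving the norming functional of `x` to a net
  -- point loses at most half of the norm.
  obtain ⟨T, hT1, hT2, hT3⟩ := (isCompact_closedBall (0 : PiLp r fun _ : ι => ℝ) 1).finite_cover_balls
    (e := 1 / 2) (by norm_num)
  have key : ∀ x : ι → ℝ, ∃ s ∈ hT2.toFinset.image WithLp.ofLp, ellNorm ρ x ≤ 2 * (x ⬝ᵥ s) := by
    intro x
    obtain ⟨t, ht, hxt⟩ := exists_dotProduct_eq_ellNorm h x
    have : WithLp.toLp r t ∈ Metric.closedBall (0 : PiLp r fun _ : ι => ℝ) 1 := by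
      simpa [ellNorm] using ht
    obtain ⟨s, hs, hst⟩ := Set.mem_iUnion₂.1 (hT3 this)
    refine ⟨s.ofLp, Finset.mem_image_of_mem _ (hT2.mem_toFinset.2 hs), ?_⟩
    rw [Metric.mem_ball, dist_eq_norm] at hst
    have hd : ellNorm r (t - s.ofLp) ≤ 1 / 2 := by
      have : ellNorm r (t - s.ofLp) = ‖WithLp.toLp r t - s‖ := by
        rw [ellNorm]; rfl
      rw [this]; exact hst.le
    have h2 := dotProduct_le_ellNorm_mul h x (t - s.ofLp)
    rw [dotProduct_sub, hxt] at h2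
    nlinarith [ellNorm_nonneg h1ρ x]
  refine ⟨hT2.toFinset.image WithLp.ofLp, ?_, fun s hs => ?_, key⟩
  · obtain ⟨s, hs, _⟩ := key 0
    exact ⟨s, hs⟩
  · obtain ⟨s', hs', rfl⟩ := Finset.mem_image.1 hs
    simpa [ellNorm] using hT1 (hT2.mem_toFinset.1 hs')

end Duality

/-! ### Diagonal operators from `ℓ_r` to `ℓ_2`. -/

section Diagonal
variable {ι : Type*} [Fintype ι] {r : ℝ≥0∞}

/-- The norm of the diagonal operator with entries `c` from `ℓ_r` to `ℓ_2`. -/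
noncomputable def diagNorm (r : ℝ≥0∞) (c : ι → ℝ) : ℝ :=
  if r ≤ 2 then ellNorm ∞ c else ellNorm (twoExp r) c

theorem two_lt_toReal (h : 2 < r) (ht : r ≠ ∞) : 2 < r.toReal := by
  simpa using (ENNReal.toReal_lt_toReal (by simp) ht).2 h

theorem toReal_twoExp (h : 2 < r) (ht : r ≠ ∞) :
    (twoExp r).toReal = 2 * (r.toReal / (r.toReal - 2)) := by
  rw [twoExp, if_neg ht, ENNReal.toReal_div, ENNReal.toReal_mul,
    ENNReal.toReal_sub_of_le h.le ht]
  simp [mul_div_assoc]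

/-- The origin of `twoExp r`: it is twice the conjugate exponent of `r / 2`, the one that arises
when Hölder's inequality is applied to squares. -/
theorem holderConjugate_div_two (h : 2 < r) (ht : r ≠ ∞) :
    (r.toReal / (r.toReal - 2)).HolderConjugate (r.toReal / 2) := by
  have h2 := two_lt_toReal h ht
  have h3 : 0 < r.toReal - 2 := by linarith
  rw [Real.holderConjugate_iff]
  refine ⟨by rw [lt_div_iff₀ h3]; linarith, ?_⟩
  field_simp
  ring

theorem one_le_twoExp (h : 2 < r) : 1 ≤ twoExp r := by
  by_cases ht : r = ∞
  · simp [twoExp, ht]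
  · have h1 := toReal_twoExp h ht
    have h2 := (holderConjugate_div_two h ht).lt
    by_contra! hlt
    have := (ENNReal.toReal_lt_toReal (ne_top_of_lt hlt) (by simp)).2 hlt
    rw [h1, ENNReal.toReal_one] at this
    linarith

theorem diagNorm_nonneg (c : ι → ℝ) : 0 ≤ diagNorm r c := by
  unfold diagNorm
  split_ifs with h
  · exact ellNorm_nonneg le_top c
  · exact ellNorm_nonneg (one_le_twoExp (not_le.1 h)) c

theorem ellNorm_two_sq (c : ι → ℝ) : ellNorm 2 c ^ 2 = ∑ i, c i ^ 2 := by
  rw [ellNorm_eq_rpow (by simp)]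
  have : 0 ≤ ∑ i, c i ^ 2 := Finset.sum_nonneg fun i _ => sq_nonneg _
  simp only [ENNReal.toReal_ofNat, Real.rpow_two, sq_abs]
  rw [← Real.sqrt_eq_rpow, Real.sq_sqrt this]

theorem ellNorm_twoExp_sq (h : 2 < r) (ht : r ≠ ∞) (c : ι → ℝ) :
    ellNorm (twoExp r) c ^ 2 =
      (∑ i, (c i ^ 2) ^ (r.toReal / (r.toReal - 2))) ^ (1 / (r.toReal / (r.toReal - 2))) := by
  have hc := holderConjugate_div_two h ht
  have hp := hc.pos
  rw [ellNorm_eq_rpow (by rw [toReal_twoExp h ht]; linarith), toReal_twoExp h ht]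
  set P := r.toReal / (r.toReal - 2)
  have e : ∀ i, |c i| ^ (2 * P) = (c i ^ 2) ^ P := fun i => by
    rw [Real.rpow_mul (abs_nonneg _), Real.rpow_two, sq_abs]
  simp only [e]
  have hn : 0 ≤ ∑ i, (c i ^ 2) ^ P := Finset.sum_nonneg fun i _ => by positivity
  rw [← Real.rpow_natCast, ← Real.rpow_mul hn]
  congr 1
  push_cast
  field_simp

/-- If `r ≤ 2`, then `|s i| ≤ 1` gives `|s i| ^ 2 ≤ |s i| ^ r`. If `2 < r < ∞`, this is Hölder for
the squares, with exponents `r / (r - 2)` and `r / 2`. For `r = ∞` only `|s i| ≤ 1` is needed. -/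
theorem sum_mul_sq_le_diagNorm (hr : 1 ≤ r) (c s : ι → ℝ) (hs : ellNorm r s ≤ 1) :
    ∑ i, (c i * s i) ^ 2 ≤ diagNorm r c ^ 2 := by
  have hs1 : ∀ i, |s i| ≤ 1 := fun i => (abs_le_ellNorm hr s i).trans hs
  unfold diagNorm
  split_ifs with h
  · have ht : r ≠ ∞ := ne_top_of_le_ne_top (by simp) h
    rw [sum_rpow_le_one hr ht] at hs
    have h2 : r.toReal ≤ 2 := by simpa using ENNReal.toReal_mono (by simp) h
    calc ∑ i, (c i * s i) ^ 2 ≤ ∑ i, ellNorm ∞ c ^ 2 * |s i| ^ r.toReal := by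
          refine Finset.sum_le_sum fun i _ => ?_
          rw [mul_pow, ← sq_abs (c i), ← sq_abs (s i)]
          refine mul_le_mul ?_ ?_ (by positivity) (by positivity)
          · exact pow_le_pow_left₀ (abs_nonneg _) (abs_le_ellNorm le_top c i) 2
          · rw [← Real.rpow_two]
            rcases (abs_nonneg (s i)).eq_or_lt with h0 | h0
            · rw [← h0, Real.zero_rpow two_ne_zero]; positivity
            · exact Real.rpow_le_rpow_of_exponent_ge h0 (hs1 i) h2
      _ = ellNorm ∞ c ^ 2 * ∑ i, |s i| ^ r.toReal := by rw [Finset.mul_sum]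
      _ ≤ _ := mul_le_of_le_one_right (by positivity) hs
  · push Not at h
    by_cases ht : r = ∞
    · rw [twoExp, if_pos ht, ellNorm_two_sq]
      refine Finset.sum_le_sum fun i _ => ?_
      rw [mul_pow]
      refine mul_le_of_le_one_right (sq_nonneg _) ?_
      rw [← sq_abs]
      exact pow_le_one₀ (abs_nonneg _) (hs1 i)
    · have hc := holderConjugate_div_two h ht
      rw [sum_rpow_le_one hr ht] at hs
      rw [ellNorm_twoExp_sq h ht]
      have := Real.inner_le_Lp_mul_Lq Finset.univ (fun i => c i ^ 2) (fun i => s i ^ 2) hc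
      simp only [← mul_pow, abs_pow, sq_abs] at this
      have e : ∀ i, (s i ^ 2) ^ (r.toReal / 2) = |s i| ^ r.toReal := fun i => by
        rw [← sq_abs, ← Real.rpow_two, ← Real.rpow_mul (abs_nonneg _)]
        congr 1; ring
      simp only [e] at this
      refine this.trans (mul_le_of_le_one_right (by positivity) ?_)
      exact Real.rpow_le_one (Finset.sum_nonneg fun i _ => by positivity) hs
        (by have := hc.symm.pos; positivity)

/-- Sharpness of `sum_mul_sq_le_diagNorm`. The extremal vector is a coordinate vector for `r ≤ 2`,
the constant `1` for `r = ∞`, and otherwise the square root of the Hölder extremizer for the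
squares. -/
theorem exists_diagNorm_le_sum (hr : 1 ≤ r) (c : ι → ℝ) :
    ∃ s, ellNorm r s ≤ 1 ∧ diagNorm r c ^ 2 ≤ ∑ i, (c i * s i) ^ 2 := by
  classical
  unfold diagNorm
  split_ifs with h
  · rcases isEmpty_or_nonempty ι with hι | hι
    · exact ⟨0, by rw [ellNorm_zero hr]; exact zero_le_one, by simp [ellNorm_top]⟩
    · obtain ⟨i, hi⟩ := exists_abs_eq_ellNorm_top c
      refine ⟨Pi.single i 1, by rw [ellNorm_single hr, abs_one], ?_⟩
      rw [← hi, sq_abs]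
      have := Finset.single_le_sum (f := fun j => (c j * (Pi.single i 1 : ι → ℝ) j) ^ 2)
        (fun j _ => sq_nonneg _) (Finset.mem_univ i)
      simpa using this
  · push Not at h
    by_cases ht : r = ∞
    · refine ⟨1, ?_, ?_⟩
      · rw [ht, ellNorm_top]
        exact Real.iSup_le (fun i => by simp) zero_le_one
      · rw [twoExp, if_pos ht, ellNorm_two_sq]
        simp
    · have hc := holderConjugate_div_two h ht
      obtain ⟨g, hg, he⟩ :=
        (NNReal.isGreatest_Lp Finset.univ (fun i => ‖c i ^ 2‖₊) hc).1
      refine ⟨fun i => Real.sqrt (g i), ?_, ?_⟩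
      · rw [sum_rpow_le_one hr ht]
        have : ∑ i, (g i : ℝ) ^ (r.toReal / 2) ≤ 1 := by exact_mod_cast hg
        refine le_trans (Finset.sum_le_sum fun i _ => le_of_eq ?_) this
        rw [abs_of_nonneg (Real.sqrt_nonneg _), Real.sqrt_eq_rpow,
          ← Real.rpow_mul (NNReal.coe_nonneg (g i))]
        congr 1; ring
      · rw [ellNorm_twoExp_sq h ht]
        have := congrArg (fun z : NNReal => (z : ℝ)) he
        push_cast at this
        simp only [norm_pow, Real.norm_eq_abs, sq_abs] at this
        rw [← this]
        refine le_of_eq (Finset.sum_congr rfl fun i _ => ?_)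
        rw [mul_pow, Real.sq_sqrt (NNReal.coe_nonneg (g i))]

end Diagonal

/-! ### Moments and tails of one Gaussian variable. -/

section Scalar

/-- The exponential square moment `𝔼 exp (g ^ 2 / 4)` of a standard Gaussian variable. -/
noncomputable def gaussExp : ℝ := ∫ x, Real.exp (x ^ 2 / 4) ∂(gaussianReal 0 1)

/-- The constant in the lower bound `gaussTail * exp (-u ^ 2)` for the Gaussian tail. -/
noncomputable def gaussTail : ℝ := (Real.sqrt (2 * Real.pi))⁻¹ * Real.exp (-1)

theorem gaussTail_pos : 0 < gaussTail := by
  unfold gaussTail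
  have := Real.pi_pos
  positivity

theorem integrable_exp_sq : Integrable (fun x : ℝ => Real.exp (x ^ 2 / 4)) (gaussianReal 0 1) := by
  rw [integrable_gaussianReal_iff]
  refine ((integrable_exp_neg_mul_sq (b := 1 / 4) (by norm_num)).const_mul
    (Real.sqrt (2 * Real.pi))⁻¹).congr (.of_forall fun x => ?_)
  simp only [gaussianPDFReal, NNReal.coe_one, mul_one, sub_zero, mul_assoc, ← Real.exp_add]
  congr 2
  ring

theorem one_le_gaussExp : 1 ≤ gaussExp := by
  have : ∫ _x : ℝ, (1 : ℝ) ∂(gaussianReal 0 1) ≤ gaussExp :=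
    integral_mono (integrable_const _) integrable_exp_sq fun x => Real.one_le_exp (by positivity)
  simpa using this

/-- Raise `y ≤ exp y`, with `y = x ^ 2 / (2 * ρ)`, to the power `ρ / 2`. This is the source of the
moment growth `√ρ`. -/
theorem abs_rpow_le_exp_sq {ρ : ℝ} (hρ : 0 < ρ) (x : ℝ) :
    |x| ^ ρ ≤ (Real.sqrt (2 * ρ)) ^ ρ * Real.exp (x ^ 2 / 4) := by
  have h1 : x ^ 2 / (2 * ρ) ≤ Real.exp (x ^ 2 / (2 * ρ)) :=
    (le_add_of_nonneg_right zero_le_one).trans (Real.add_one_le_exp _)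
  have h2 : (x ^ 2 / (2 * ρ)) ^ (ρ / 2) ≤ Real.exp (x ^ 2 / 4) := by
    refine (Real.rpow_le_rpow (by positivity) h1 (by positivity)).trans (le_of_eq ?_)
    rw [← Real.exp_mul]
    congr 1
    field_simp
    norm_num
  rw [Real.div_rpow (sq_nonneg x) (by positivity), div_le_iff₀ (by positivity)] at h2
  have e1 : (x ^ 2) ^ (ρ / 2) = |x| ^ ρ := by
    rw [← sq_abs, ← Real.rpow_two, ← Real.rpow_mul (abs_nonneg _)]
    congr 1; ring
  have e2 : (2 * ρ) ^ (ρ / 2) = (Real.sqrt (2 * ρ)) ^ ρ := by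
    rw [Real.sqrt_eq_rpow, ← Real.rpow_mul (by positivity)]
    congr 1; ring
  rw [e1, e2] at h2
  linarith

/-- For `y = |x| - u ≥ 0` one has `y ≤ y ^ 2 / 4 + 1` and `y ^ 2 ≤ x ^ 2 - u ^ 2`; then `1 + z ≤ exp
z`. -/
theorem abs_le_add_exp_sq {u : ℝ} (hu : 0 ≤ u) (x : ℝ) :
    |x| ≤ u + Real.exp (-u ^ 2 / 4) * Real.exp (x ^ 2 / 4) := by
  rw [← Real.exp_add]
  rcases le_total |x| u with h | h
  · exact h.trans (le_add_of_nonneg_right (Real.exp_pos _).le)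
  · have h1 := Real.add_one_le_exp (-u ^ 2 / 4 + x ^ 2 / 4)
    have h2 : (|x| - u) ^ 2 ≤ x ^ 2 - u ^ 2 := by
      rw [← sq_abs x]; nlinarith
    nlinarith [sq_nonneg (|x| - u - 2)]

/-- Integrate the density over the unit interval `[u, u + 1]`, where `x ^ 2 / 2 ≤ u ^ 2 + 1`. -/
theorem gaussTail_mul_le (u : ℝ) :
    gaussTail * Real.exp (-u ^ 2) ≤ (gaussianReal 0 1).real {x | u ≤ |x|} := by
  have hs : Set.Icc u (u + 1) ⊆ {x : ℝ | u ≤ |x|} := fun x hx => hx.1.trans (le_abs_self x)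
  refine le_trans ?_ (measureReal_mono hs (measure_ne_top _ _))
  rw [measureReal_def, gaussianReal_apply_eq_integral 0 one_ne_zero, ENNReal.toReal_ofReal
    (setIntegral_nonneg measurableSet_Icc fun x _ => gaussianPDFReal_nonneg _ _ _)]
  have hc : ∫ _x in Set.Icc u (u + 1), gaussTail * Real.exp (-u ^ 2) =
      gaussTail * Real.exp (-u ^ 2) := by simp
  rw [← hc]
  refine setIntegral_mono_on (integrableOn_const (by simp)) (integrable_gaussianPDFReal 0 1).integrableOn
    measurableSet_Icc fun x hx => ?_
  rw [gaussTail, mul_assoc, ← Real.exp_add]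
  simp only [gaussianPDFReal, NNReal.coe_one, mul_one, sub_zero]
  refine mul_le_mul_of_nonneg_left (Real.exp_le_exp.2 ?_) (by positivity)
  have h1 := hx.1
  have h2 := hx.2
  nlinarith [sq_nonneg (u - 1)]

end Scalar

/-! ### Integrals of `ℓ_ρ` norms. -/

section EllNormIntegral
variable {ι Ω : Type*} [Fintype ι] [MeasurableSpace Ω] {P : Measure Ω} {ρ : ℝ≥0∞}

theorem ellNorm_le_sum_abs (h : 1 ≤ ρ) (x : ι → ℝ) : ellNorm ρ x ≤ ∑ i, |x i| := by
  classical
  have : Fact (1 ≤ ρ) := ⟨h⟩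
  have e : WithLp.toLp ρ x = ∑ i, WithLp.toLp ρ (Pi.single i (x i)) := by
    ext j
    simp [Finset.sum_pi_single]
  rw [ellNorm, e]
  refine (norm_sum_le _ _).trans (Finset.sum_le_sum fun i _ => ?_)
  exact (ellNorm_single h i (x i)).le

theorem continuous_ellNorm (h : 1 ≤ ρ) : Continuous (ellNorm ρ : (ι → ℝ) → ℝ) := by
  have : Fact (1 ≤ ρ) := ⟨h⟩
  exact continuous_norm.comp (PiLp.continuous_toLp ρ fun _ : ι => ℝ)

theorem integrable_ellNorm (h : 1 ≤ ρ) {f : ι → Ω → ℝ} (hf : ∀ i, Integrable (f i) P) :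
    Integrable (fun ω => ellNorm ρ fun i => f i ω) P := by
  refine (integrable_finsetSum Finset.univ fun i _ => (hf i).abs).mono' ?_ (.of_forall fun ω => ?_)
  · exact (continuous_ellNorm h).comp_aestronglyMeasurable
      (aemeasurable_pi_lambda _ fun i => (hf i).aemeasurable).aestronglyMeasurable
  · rw [Real.norm_eq_abs, abs_of_nonneg (ellNorm_nonneg h _)]
    exact ellNorm_le_sum_abs h _

/-- Jensen's inequality for `ellNorm`. -/
theorem ellNorm_integral_le (h : 1 ≤ ρ) {f : ι → Ω → ℝ} (hf : ∀ i, Integrable (f i) P) :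
    ellNorm ρ (fun i => ∫ ω, f i ω ∂P) ≤ ∫ ω, ellNorm ρ (fun i => f i ω) ∂P := by
  have hr := ENNReal.HolderConjugate.conjExponent h
  obtain ⟨t, ht1, ht2⟩ := exists_dotProduct_eq_ellNorm hr fun i => ∫ ω, f i ω ∂P
  rw [← ht2]
  have e : (fun i => ∫ ω, f i ω ∂P) ⬝ᵥ t = ∫ ω, (fun i => f i ω) ⬝ᵥ t ∂P := by
    simp only [dotProduct]
    rw [integral_finsetSum _ fun i _ => (hf i).mul_const _]
    simp only [integral_mul_const]
  rw [e]
  refine integral_mono (integrable_finsetSum _ fun i _ => (hf i).mul_const _)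
    (integrable_ellNorm h hf) fun ω => ?_
  exact (dotProduct_le_ellNorm_mul hr _ t).trans
    (mul_le_of_le_one_right (ellNorm_nonneg h _) ht1)

end EllNormIntegral

/-! ### Integrability for families of Gaussian variables. -/

section GaussianFamily
variable {ι Ω : Type*} [MeasurableSpace Ω] {P : Measure Ω} {g : ι → Ω → ℝ}

theorem integrable_comp_of_hasLaw_gaussian {X : Ω → ℝ} (hX : HasLaw X (gaussianReal 0 1) P)
    {f : ℝ → ℝ} (hf : Integrable f (gaussianReal 0 1)) : Integrable (fun ω => f (X ω)) P := by
  have := hf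
  rw [← hX.map_eq] at this
  exact this.comp_aemeasurable hX.aemeasurable

theorem integrable_const_mul_gaussian (hg : ∀ i, HasLaw (g i) (gaussianReal 0 1) P) (c : ι → ℝ)
    (i : ι) : Integrable (fun ω => c i * g i ω) P :=
  (integrable_comp_of_hasLaw_gaussian (hg i) integrable_id_gaussian).const_mul _

theorem integrable_exp_sq_comp (hg : ∀ i, HasLaw (g i) (gaussianReal 0 1) P) (i : ι) :
    Integrable (fun ω => Real.exp (g i ω ^ 2 / 4)) P :=
  integrable_comp_of_hasLaw_gaussian (hg i) integrable_exp_sq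

theorem integral_exp_sq_comp (hg : ∀ i, HasLaw (g i) (gaussianReal 0 1) P) (i : ι) :
    ∫ ω, Real.exp (g i ω ^ 2 / 4) ∂P = gaussExp :=
  (hg i).integral_comp (f := fun x => Real.exp (x ^ 2 / 4)) integrable_exp_sq.1

theorem integral_const_add_const_mul [IsProbabilityMeasure P] {f : Ω → ℝ} (hf : Integrable f P)
    (a b : ℝ) : ∫ ω, (a + b * f ω) ∂P = a + b * ∫ ω, f ω ∂P := by
  rw [integral_add (integrable_const _) (hf.const_mul _), integral_const_mul]
  simp

end GaussianFamily

/-! ### Moment bounds, and the expected maximum as an Orlicz norm. -/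

section Sequence
variable {ι Ω : Type*} [Fintype ι] [MeasurableSpace Ω] {P : Measure Ω} {ρ : ℝ≥0∞}
  {g : ι → Ω → ℝ}

theorem integrable_ellNorm_gaussian (hg : ∀ i, HasLaw (g i) (gaussianReal 0 1) P) (h : 1 ≤ ρ)
    (c : ι → ℝ) : Integrable (fun ω => ellNorm ρ fun i => c i * g i ω) P :=
  integrable_ellNorm h fun i => integrable_const_mul_gaussian hg c i

theorem ellNorm_eq_zero_iff (h : 1 ≤ ρ) {x : ι → ℝ} : ellNorm ρ x = 0 ↔ x = 0 := by
  refine ⟨fun hx => ?_, fun hx => hx ▸ ellNorm_zero h⟩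
  ext i
  exact abs_nonpos_iff.1 ((abs_le_ellNorm h x i).trans hx.le)

theorem ellNorm_rpow (h : 1 ≤ ρ) (ht : ρ ≠ ∞) (x : ι → ℝ) :
    ellNorm ρ x ^ ρ.toReal = ∑ i, |x i| ^ ρ.toReal := by
  have h0 : 0 < ρ.toReal := by linarith [one_le_toReal h ht]
  rw [ellNorm_eq_rpow h0, ← Real.rpow_mul (Finset.sum_nonneg fun i _ => by positivity),
    one_div_mul_cancel h0.ne', Real.rpow_one]

theorem integral_ellNorm_gaussian_le [IsProbabilityMeasure P]
    (hg : ∀ i, HasLaw (g i) (gaussianReal 0 1) P) (h : 1 ≤ ρ) (ht : ρ ≠ ∞) (c : ι → ℝ) :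
    ∫ ω, ellNorm ρ (fun i => c i * g i ω) ∂P ≤
      4 * gaussExp * (Real.sqrt ρ.toReal * ellNorm ρ c) := by
  have hr := one_le_toReal h ht
  have h0 : 0 < ρ.toReal := by linarith
  have hG := one_le_gaussExp
  rcases (ellNorm_nonneg h c).eq_or_lt with hc | hc
  · rw [← hc]
    have hc0 := (ellNorm_eq_zero_iff h).1 hc.symm
    subst hc0
    have : ∀ ω, (fun i => (0 : ι → ℝ) i * g i ω) = 0 := fun ω => by ext; simp
    simp_rw [this]
    simp [ellNorm_zero h]
  set r := ρ.toReal
  -- The level `lam` is chosen with `𝔼 Y ^ r ≤ lam ^ r`. Truncation at it, `Y ≤ lam + lam ^ (1 - r)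
  -- * Y ^ r`, then yields `𝔼 Y ≤ 2 * lam`.
  set lam : ℝ := gaussExp * (Real.sqrt (2 * r) * ellNorm ρ c) with hlam
  have hlam0 : 0 < lam := by positivity
  have hpt : ∀ ω, ellNorm ρ (fun i => c i * g i ω) ≤ lam + lam ^ (1 - r) *
      ∑ i, |c i| ^ r * (Real.sqrt (2 * r) ^ r * Real.exp (g i ω ^ 2 / 4)) := fun ω => by
    set Y := ellNorm ρ (fun i => c i * g i ω) with hY
    have hY0 : 0 ≤ Y := ellNorm_nonneg h _
    have hYr : Y ^ r ≤ ∑ i, |c i| ^ r * (Real.sqrt (2 * r) ^ r * Real.exp (g i ω ^ 2 / 4)) := by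
      rw [hY, ellNorm_rpow h ht]
      refine Finset.sum_le_sum fun i _ => ?_
      rw [abs_mul, Real.mul_rpow (abs_nonneg _) (abs_nonneg _)]
      exact mul_le_mul_of_nonneg_left (abs_rpow_le_exp_sq h0 _) (by positivity)
    refine le_trans ?_ (add_le_add le_rfl (mul_le_mul_of_nonneg_left hYr (by positivity)))
    rcases le_total Y lam with hle | hle
    · exact hle.trans (le_add_of_nonneg_right (by positivity))
    · have hYp : 0 < Y := hlam0.trans_le hle
      have : Y = Y ^ (1 - r) * Y ^ r := by rw [← Real.rpow_add hYp]; simp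
      refine le_trans this.le (le_trans ?_ (le_add_of_nonneg_left hlam0.le))
      refine mul_le_mul_of_nonneg_right ?_ (by positivity)
      exact Real.rpow_le_rpow_of_nonpos hlam0 hle (by linarith)
  have hint : Integrable (fun ω => ∑ i, |c i| ^ r * (Real.sqrt (2 * r) ^ r *
      Real.exp (g i ω ^ 2 / 4))) P :=
    integrable_finsetSum _ fun i _ => ((integrable_exp_sq_comp hg i).const_mul _).const_mul _
  have hE : ∫ ω, ∑ i, |c i| ^ r * (Real.sqrt (2 * r) ^ r * Real.exp (g i ω ^ 2 / 4)) ∂P ≤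
      lam ^ r := by
    rw [integral_finsetSum _ fun i _ =>
      ((integrable_exp_sq_comp hg i).const_mul _).const_mul _]
    simp only [integral_const_mul, integral_exp_sq_comp hg]
    rw [← Finset.sum_mul, ← ellNorm_rpow h ht, hlam, Real.mul_rpow (by positivity) (by positivity),
      Real.mul_rpow (by positivity) (by positivity)]
    have : gaussExp ≤ gaussExp ^ r := Real.self_le_rpow_of_one_le hG hr
    calc ellNorm ρ c ^ r * (Real.sqrt (2 * r) ^ r * gaussExp)
        = gaussExp * (Real.sqrt (2 * r) ^ r * ellNorm ρ c ^ r) := by ring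
      _ ≤ _ := mul_le_mul_of_nonneg_right this (by positivity)
  have h2 : Real.sqrt (2 * r) ≤ 2 * Real.sqrt r := by
    rw [Real.sqrt_mul (by norm_num)]
    refine mul_le_mul_of_nonneg_right ?_ (Real.sqrt_nonneg _)
    rw [Real.sqrt_le_left (by norm_num)]; norm_num
  calc ∫ ω, ellNorm ρ (fun i => c i * g i ω) ∂P
      ≤ ∫ ω, (lam + lam ^ (1 - r) *
      ∑ i, |c i| ^ r * (Real.sqrt (2 * r) ^ r * Real.exp (g i ω ^ 2 / 4))) ∂P :=
        integral_mono (integrable_ellNorm_gaussian hg h c)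
          ((integrable_const _).add (hint.const_mul _)) hpt
    _ = lam + lam ^ (1 - r) * ∫ ω, ∑ i, |c i| ^ r *
          (Real.sqrt (2 * r) ^ r * Real.exp (g i ω ^ 2 / 4)) ∂P := by
        exact integral_const_add_const_mul hint _ _
    _ ≤ lam + lam ^ (1 - r) * lam ^ r := by gcongr
    _ = 2 * lam := by rw [← Real.rpow_add hlam0]; simp; ring
    _ ≤ 2 * (gaussExp * (2 * Real.sqrt r * ellNorm ρ c)) := by rw [hlam]; gcongr
    _ = _ := by ring

theorem orliczPhi_two {s : ℝ} (hs : 0 < s) : orliczPhi 2 s = Real.exp (2 - 2 * (s ^ 2)⁻¹) := by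
  rw [orliczPhi, if_pos hs, Real.rpow_neg hs.le, Real.rpow_two]

theorem orliczPhi_nonneg (ρ s : ℝ) : 0 ≤ orliczPhi ρ s := by
  unfold orliczPhi
  split_ifs <;> positivity

/-- Each entry is at most a common level of order `t` plus an excess of mean at most `t * φ_2(|c i|
/ t) * gaussExp`. Bounding the largest excess by the sum of all of them makes the Orlicz condition
appear. -/
theorem integral_ellNorm_top_gaussian_le [IsProbabilityMeasure P]
    (hg : ∀ i, HasLaw (g i) (gaussianReal 0 1) P) (c : ι → ℝ) {t : ℝ} (ht : 0 < t)
    (hc : ∑ i, orliczPhi 2 (|c i| / t) ≤ 1) :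
    ∫ ω, ellNorm ∞ (fun i => c i * g i ω) ∂P ≤ (3 + gaussExp) * t := by
  have hG := one_le_gaussExp
  have hpt : ∀ i (x : ℝ), |c i * x| ≤ 3 * t + t * (orliczPhi 2 (|c i| / t) * Real.exp (x ^ 2 / 4)) := by
    intro i x
    have hphi := orliczPhi_nonneg 2 (|c i| / t)
    rcases eq_or_ne (c i) 0 with h0 | h0
    · rw [h0, zero_mul, abs_zero]
      rw [h0, abs_zero] at hphi
      positivity
    have hci : 0 < |c i| := abs_pos.2 h0
    have hle : orliczPhi 2 (|c i| / t) ≤ 1 :=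
      (Finset.single_le_sum (fun j _ => orliczPhi_nonneg 2 (|c j| / t)) (Finset.mem_univ i)).trans hc
    have e := orliczPhi_two (div_pos hci ht)
    have hct : |c i| ≤ t := by
      rw [e, Real.exp_le_one_iff, div_pow, inv_div] at hle
      have h1 : 1 ≤ t ^ 2 / |c i| ^ 2 := by linarith
      rw [one_le_div (by positivity)] at h1
      exact (pow_le_pow_iff_left₀ hci.le ht.le two_ne_zero).1 h1
    -- With this cutoff, `exp (-u ^ 2 / 4)` is `exp (-2)` times `φ_2(|c i| / t)`.
    have h1 := abs_le_add_exp_sq (u := Real.sqrt 8 * t / |c i|) (by positivity) x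
    have e2 : Real.exp (-(Real.sqrt 8 * t / |c i|) ^ 2 / 4) ≤ orliczPhi 2 (|c i| / t) := by
      rw [e, Real.exp_le_exp, div_pow, div_pow, mul_pow, Real.sq_sqrt (by norm_num), inv_div]
      have : -(8 * t ^ 2 / |c i| ^ 2) / 4 = -2 * (t ^ 2 / |c i| ^ 2) := by ring
      rw [this]; linarith
    have h8 : Real.sqrt 8 ≤ 3 := by rw [Real.sqrt_le_left (by norm_num)]; norm_num
    rw [abs_mul]
    calc |c i| * |x| ≤ |c i| * (Real.sqrt 8 * t / |c i| +
          Real.exp (-(Real.sqrt 8 * t / |c i|) ^ 2 / 4) * Real.exp (x ^ 2 / 4)) := by gcongr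
      _ = Real.sqrt 8 * t + |c i| * (Real.exp (-(Real.sqrt 8 * t / |c i|) ^ 2 / 4) *
          Real.exp (x ^ 2 / 4)) := by field_simp
      _ ≤ _ := by gcongr
  have hint : ∀ i, Integrable (fun ω => orliczPhi 2 (|c i| / t) * Real.exp (g i ω ^ 2 / 4)) P :=
    fun i => (integrable_exp_sq_comp hg i).const_mul _
  have hsum : Integrable (fun ω => ∑ i, orliczPhi 2 (|c i| / t) * Real.exp (g i ω ^ 2 / 4)) P :=
    integrable_finsetSum _ fun i _ => hint i
  have hsn : ∀ ω i, 0 ≤ orliczPhi 2 (|c i| / t) * Real.exp (g i ω ^ 2 / 4) := fun ω i =>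
    mul_nonneg (orliczPhi_nonneg _ _) (Real.exp_pos _).le
  calc ∫ ω, ellNorm ∞ (fun i => c i * g i ω) ∂P
      ≤ ∫ ω, (3 * t + t * ∑ i, orliczPhi 2 (|c i| / t) * Real.exp (g i ω ^ 2 / 4)) ∂P := by
        refine integral_mono (integrable_ellNorm_gaussian hg le_top c)
          ((integrable_const _).add (hsum.const_mul _)) fun ω => ?_
        simp only [ellNorm_top]
        refine Real.iSup_le (fun i => (hpt i _).trans ?_) ?_
        · gcongr
          exact Finset.single_le_sum (fun j _ => hsn ω j) (Finset.mem_univ i)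
        · have := Finset.sum_nonneg fun i (_ : i ∈ Finset.univ) => hsn ω i
          positivity
    _ = 3 * t + t * ((∑ i, orliczPhi 2 (|c i| / t)) * gaussExp) := by
        rw [integral_const_add_const_mul hsum, integral_finsetSum _ fun i _ => hint i,
          Finset.sum_mul]
        simp only [integral_const_mul, integral_exp_sq_comp hg]
    _ ≤ 3 * t + t * (1 * gaussExp) := by gcongr
    _ = _ := by ring

/-- A lower bound for the expected maximum of independent Gaussian variables by their tails. -/
theorem mul_one_sub_exp_le_integral_ellNorm_top [IsProbabilityMeasure P]
    (hg : ∀ i, HasLaw (g i) (gaussianReal 0 1) P) (hind : iIndepFun g P) (c : ι → ℝ) {t d : ℝ}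
    (ht : 0 ≤ t) (hd : d ≤ ∑ i, (gaussianReal 0 1).real {x | t ≤ |c i * x|}) :
    t * (1 - Real.exp (-d)) ≤ ∫ ω, ellNorm ∞ (fun i => c i * g i ω) ∂P := by
  have hmeas : ∀ i, MeasurableSet {x : ℝ | t ≤ |c i * x|} := fun i =>
    measurableSet_le measurable_const (by fun_prop)
  have hint := integrable_ellNorm_gaussian hg (ρ := ∞) le_top c
  -- By Markov's inequality it suffices that the maximum stays below `t` with probability at most
  -- `exp (-d)`. By independence this probability is at most `∏ (1 - p_i) ≤ exp (-∑ p_i)`.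
  have hmarkov := mul_meas_ge_le_integral_of_nonneg (μ := P)
    (f := fun ω => ellNorm ∞ (fun i => c i * g i ω)) (.of_forall fun ω => ellNorm_nonneg le_top _)
    hint t
  refine le_trans (mul_le_mul_of_nonneg_left ?_ ht) hmarkov
  have hset : {ω | t ≤ ellNorm ∞ (fun i => c i * g i ω)}ᶜ ⊆
      ⋂ i ∈ Finset.univ, g i ⁻¹' {x : ℝ | t ≤ |c i * x|}ᶜ := by
    intro ω hω
    simp only [Set.mem_compl_iff, Set.mem_ofPred_eq, not_le] at hω
    simp only [Finset.mem_univ, Set.iInter_true, Set.mem_iInter, Set.mem_preimage,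
      Set.mem_compl_iff, Set.mem_ofPred_eq, not_le]
    exact fun i => (abs_le_ellNorm le_top (fun i => c i * g i ω) i).trans_lt hω
  have hprod := hind.measure_inter_preimage_eq_mul Finset.univ
    (sets := fun i => {x : ℝ | t ≤ |c i * x|}ᶜ) fun i _ => (hmeas i).compl
  have hi : ∀ i, P.real (g i ⁻¹' {x : ℝ | t ≤ |c i * x|}ᶜ) =
      1 - (gaussianReal 0 1).real {x | t ≤ |c i * x|} := fun i => by
    rw [← probReal_compl_eq_one_sub (hmeas i), measureReal_def, measureReal_def, ← (hg i).map_eq,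
      Measure.map_apply_of_aemeasurable (hg i).aemeasurable (hmeas i).compl]
  have hle : P.real {ω | t ≤ ellNorm ∞ (fun i => c i * g i ω)}ᶜ ≤ Real.exp (-d) := by
    refine (measureReal_mono hset (measure_ne_top _ _)).trans ?_
    rw [measureReal_def, hprod, ENNReal.toReal_prod]
    change ∏ i, P.real (g i ⁻¹' {x : ℝ | t ≤ |c i * x|}ᶜ) ≤ _
    simp only [hi]
    calc ∏ i, (1 - (gaussianReal 0 1).real {x | t ≤ |c i * x|})
        ≤ ∏ i, Real.exp (-(gaussianReal 0 1).real {x | t ≤ |c i * x|}) :=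
          Finset.prod_le_prod (fun i _ => sub_nonneg.2 measureReal_le_one)
            fun i _ => Real.one_sub_le_exp_neg _
      _ = Real.exp (-∑ i, (gaussianReal 0 1).real {x | t ≤ |c i * x|}) := by
          rw [← Real.exp_sum, Finset.sum_neg_distrib]
      _ ≤ _ := Real.exp_le_exp.2 (neg_le_neg hd)
  have hnull : NullMeasurableSet {ω | t ≤ ellNorm ∞ (fun i => c i * g i ω)} P :=
    nullMeasurableSet_le aemeasurable_const hint.aemeasurable
  rw [probReal_compl_eq_one_sub₀ hnull] at hle
  linarith

theorem gaussTail_mul_exp_le_of_ne_zero {c : ℝ} (hc : c ≠ 0) (t : ℝ) :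
    gaussTail * Real.exp (-(t / |c|) ^ 2) ≤ (gaussianReal 0 1).real {x | t ≤ |c * x|} := by
  have : {x : ℝ | t ≤ |c * x|} = {x | t / |c| ≤ |x|} := by
    ext x
    simp only [Set.mem_ofPred_eq]
    rw [abs_mul, div_le_iff₀' (abs_pos.2 hc)]
  rw [this]
  exact gaussTail_mul_le _

theorem orliczNorm_nonneg (ρ : ℝ) (c : ι → ℝ) : 0 ≤ orliczNorm ρ c :=
  Real.sInf_nonneg fun _ ht => ht.1.le

/-- Below the Luxemburg norm the sum of `φ_2(|c i| / t)` exceeds `1`. At level `√2 * t` the lower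
tail bounds are exactly `gaussTail * exp (-2)` times these terms, so the maximum reaches that level
with probability bounded below. -/
theorem mul_orliczNorm_le_integral [IsProbabilityMeasure P]
    (hg : ∀ i, HasLaw (g i) (gaussianReal 0 1) P) (hind : iIndepFun g P) (c : ι → ℝ) :
    (1 - Real.exp (-(gaussTail * Real.exp (-2)))) * orliczNorm 2 c ≤
      ∫ ω, ellNorm ∞ (fun i => c i * g i ω) ∂P := by
  set κ := 1 - Real.exp (-(gaussTail * Real.exp (-2))) with hκ
  have hκ0 : 0 < κ := by
    rw [hκ, sub_pos, Real.exp_lt_one_iff, neg_lt_zero]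
    exact mul_pos gaussTail_pos (Real.exp_pos _)
  have hI : 0 ≤ ∫ ω, ellNorm ∞ (fun i => c i * g i ω) ∂P :=
    integral_nonneg fun ω => ellNorm_nonneg le_top _
  rw [← le_div_iff₀' hκ0]
  refine le_of_forall_lt fun s hs => ?_
  by_contra! hle
  obtain ⟨t, hst, ht⟩ := exists_between hs
  have ht0 : 0 < t := lt_of_le_of_lt ((div_nonneg hI hκ0.le).trans hle) hst
  have hnot : 1 < ∑ i, orliczPhi 2 (|c i| / t) := by
    by_contra! h
    have hb : BddBelow {t : ℝ | 0 < t ∧ ∑ i, orliczPhi 2 (|c i| / t) ≤ 1} :=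
      ⟨0, fun _ h => h.1.le⟩
    exact absurd (csInf_le hb ⟨ht0, h⟩) (not_le.2 ht)
  have hsum : gaussTail * Real.exp (-2) ≤
      ∑ i, (gaussianReal 0 1).real {x | Real.sqrt 2 * t ≤ |c i * x|} := by
    calc gaussTail * Real.exp (-2) ≤
        gaussTail * Real.exp (-2) * ∑ i, orliczPhi 2 (|c i| / t) :=
          le_mul_of_one_le_right (mul_pos gaussTail_pos (Real.exp_pos _)).le hnot.le
      _ = ∑ i, gaussTail * Real.exp (-2) * orliczPhi 2 (|c i| / t) := by rw [Finset.mul_sum]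
      _ ≤ _ := by
        refine Finset.sum_le_sum fun i _ => ?_
        rcases eq_or_ne (c i) 0 with h0 | h0
        · rw [h0, abs_zero, zero_div, orliczPhi, if_neg (lt_irrefl _), mul_zero]
          exact measureReal_nonneg
        · refine le_trans (le_of_eq ?_) (gaussTail_mul_exp_le_of_ne_zero h0 _)
          rw [orliczPhi_two (div_pos (abs_pos.2 h0) ht0), mul_assoc, ← Real.exp_add]
          congr 2
          rw [div_pow, div_pow, mul_pow, Real.sq_sqrt (by norm_num), inv_div]
          ring
  have h1 := mul_one_sub_exp_le_integral_ellNorm_top hg hind c (by positivity) hsum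
  rw [← hκ] at h1
  have h2 : (1 : ℝ) ≤ Real.sqrt 2 := Real.one_le_sqrt.2 one_le_two
  rw [div_le_iff₀ hκ0] at hle
  have h3 : t * κ ≤ Real.sqrt 2 * t * κ := by
    rw [mul_assoc]; exact le_mul_of_one_le_left (by positivity) h2
  nlinarith

/-- Nonemptiness of the set in the Luxemburg infimum, needed to bound that infimum from below. At
scale `M * √(1 + k)` each term is at most `exp (-2 * k)`, and there are `k` of them. -/
theorem exists_orlicz_le_one (c : ι → ℝ) : ∃ t : ℝ, 0 < t ∧ ∑ i, orliczPhi 2 (|c i| / t) ≤ 1 := by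
  set k : ℝ := ((Fintype.card ι : ℕ) : ℝ) with hk
  have hk0 : 0 ≤ k := Nat.cast_nonneg _
  set M := ellNorm ∞ c + 1 with hM
  have hM0 : 0 < M := by linarith [ellNorm_nonneg le_top c]
  refine ⟨M * Real.sqrt (1 + k), by positivity, ?_⟩
  have h1 : ∀ i, orliczPhi 2 (|c i| / (M * Real.sqrt (1 + k))) ≤ Real.exp (-2 * k) := fun i => by
    rcases eq_or_ne (c i) 0 with h0 | h0
    · rw [h0, abs_zero, zero_div, orliczPhi, if_neg (lt_irrefl _)]
      positivity
    · have hci := abs_pos.2 h0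
      rw [orliczPhi_two (by positivity), Real.exp_le_exp, div_pow, mul_pow,
        Real.sq_sqrt (by positivity), inv_div]
      have hcM : |c i| ^ 2 ≤ M ^ 2 :=
        pow_le_pow_left₀ hci.le (by linarith [abs_le_ellNorm le_top c i]) 2
      have : 1 + k ≤ M ^ 2 * (1 + k) / |c i| ^ 2 := by
        rw [le_div_iff₀ (by positivity), mul_comm]
        gcongr
      linarith
  calc ∑ i, orliczPhi 2 (|c i| / (M * Real.sqrt (1 + k))) ≤ ∑ _i : ι, Real.exp (-2 * k) :=
        Finset.sum_le_sum fun i _ => h1 i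
    _ = k * Real.exp (-2 * k) := by simp [hk]
    _ ≤ Real.exp (2 * k) * Real.exp (-2 * k) := by
        gcongr
        linarith [Real.add_one_le_exp (2 * k)]
    _ = 1 := by rw [← Real.exp_add]; simp

theorem integral_ellNorm_top_le_orliczNorm [IsProbabilityMeasure P]
    (hg : ∀ i, HasLaw (g i) (gaussianReal 0 1) P) (c : ι → ℝ) :
    ∫ ω, ellNorm ∞ (fun i => c i * g i ω) ∂P ≤ (3 + gaussExp) * orliczNorm 2 c := by
  have hG : 0 < 3 + gaussExp := by linarith [one_le_gaussExp]
  rw [← div_le_iff₀' hG]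
  obtain ⟨t, ht⟩ := exists_orlicz_le_one c
  refine le_csInf ⟨t, ht⟩ fun s hs => ?_
  rw [div_le_iff₀' hG]
  exact integral_ellNorm_top_gaussian_le hg c hs.1 hs.2

/-- Jensen's inequality for the vector `|c i * g i|`, with `𝔼 |g| ≥ ℙ(|g| ≥ 1)`. No independence
enters. -/
theorem ellNorm_le_integral_gaussian (hg : ∀ i, HasLaw (g i) (gaussianReal 0 1) P)
    (h : 1 ≤ ρ) (c : ι → ℝ) :
    gaussTail * Real.exp (-1) * ellNorm ρ c ≤ ∫ ω, ellNorm ρ (fun i => c i * g i ω) ∂P := by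
  have hi : ∀ i, Integrable (fun ω => |c i * g i ω|) P := fun i =>
    (integrable_const_mul_gaussian hg c i).abs
  have h0 : gaussTail * Real.exp (-1) ≤ ∫ x, |x| ∂(gaussianReal 0 1) := by
    have h1 := gaussTail_mul_le 1
    have h2 := mul_meas_ge_le_integral_of_nonneg (μ := gaussianReal 0 1) (f := fun x : ℝ => |x|)
      (.of_forall fun x => abs_nonneg x) integrable_id_gaussian.abs 1
    rw [one_mul] at h2
    simp only [one_pow] at h1
    exact h1.trans h2
  have hpos : 0 ≤ gaussTail * Real.exp (-1) := (mul_pos gaussTail_pos (Real.exp_pos _)).le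
  have hj := ellNorm_integral_le h hi
  have e : ∀ ω, ellNorm ρ (fun i => |c i * g i ω|) = ellNorm ρ (fun i => c i * g i ω) := fun ω =>
    ellNorm_congr_abs h fun i => abs_abs _
  simp only [e] at hj
  refine le_trans ?_ hj
  rw [← abs_of_nonneg hpos, ← ellNorm_smul h]
  refine ellNorm_mono h fun i => ?_
  have e1 : ∫ ω, |g i ω| ∂P = ∫ x, |x| ∂(gaussianReal 0 1) :=
    (hg i).integral_comp (f := fun x => |x|) integrable_id_gaussian.abs.1
  simp only [abs_mul (c i), Pi.smul_apply, smul_eq_mul]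
  rw [integral_const_mul, e1, abs_mul (gaussTail * Real.exp (-1)), abs_mul |c i|, abs_abs,
    abs_of_nonneg hpos, abs_of_nonneg (hpos.trans h0), mul_comm]
  exact mul_le_mul_of_nonneg_left h0 (abs_nonneg _)

end Sequence

/-! ### Maxima over consecutive blocks of indices. -/

section Blocks

/-- Only the last block can be incomplete, and the block preceding that of `i` is not the last. -/
theorem card_block_ge {k K : ℕ} (i : Fin k) (hi : K ≤ i) (hK : 0 < K) :
    K ≤ (Finset.univ.filter fun j : Fin k => (j : ℕ) / K + 1 = i / K).card := by
  have hdiv : 1 ≤ (i : ℕ) / K := (Nat.one_le_div_iff hK).2 hi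
  obtain ⟨l, hl⟩ : ∃ l, (i : ℕ) / K = l + 1 := ⟨(i : ℕ) / K - 1, by omega⟩
  have hlt : ∀ r : Fin K, l * K + r < k := fun r => by
    have h1 : (i : ℕ) / K * K ≤ i := Nat.div_mul_le_self _ _
    rw [hl, add_mul, one_mul] at h1
    have := r.2
    have := i.2
    omega
  have h := Finset.card_le_card_of_injOn (s := (Finset.univ : Finset (Fin K)))
    (t := Finset.univ.filter fun j : Fin k => (j : ℕ) / K + 1 = i / K)
    (fun r => ⟨l * K + r, hlt r⟩) (fun r _ => by
      simp only [Finset.coe_filter, Finset.mem_univ, true_and, Set.mem_ofPred_eq]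
      rw [hl, mul_comm, Nat.mul_add_div hK, Nat.div_eq_of_lt r.2, add_zero])
    (fun r _ s _ hrs => by
      simp only [Fin.mk.injEq] at hrs
      ext; omega)
  simpa using h

theorem card_block_le {k K : ℕ} (hK : 0 < K) (l : ℕ) :
    (Finset.univ.filter fun i : Fin k => (i : ℕ) / K = l).card ≤ K := by
  have h := Finset.card_le_card_of_injOn (s := Finset.univ.filter fun i : Fin k => (i : ℕ) / K = l)
    (t := Finset.range K) (fun i => (i : ℕ) % K)
    (fun i _ => by simpa using Nat.mod_lt _ hK) (fun i hi j hj hij => by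
      simp only [Finset.coe_filter, Finset.mem_univ, true_and, Set.mem_ofPred_eq] at hi hj
      ext
      rw [← Nat.div_add_mod i K, ← Nat.div_add_mod j K, hi, hj]
      simp only at hij
      rw [hij])
  simpa using h

/-- Replacing each entry by the maximum of the previous block of length `K` raises the `ℓ_r` norm
of a nonincreasing weighted sequence at most by the factor `K ^ (1 / r)`. -/
theorem sum_block_max_le {k K : ℕ} (hK : 0 < K) {r : ℝ} (hr : 0 < r) (d x : Fin k → ℝ)
    (hd : Antitone d) (hd0 : ∀ i, 0 ≤ d i) :
    ∑ i : Fin k, (if K ≤ i then d i * ellNorm ∞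
      (fun j : Fin k => (if (j : ℕ) / K + 1 = i / K then 1 else 0) * x j) else 0) ^ r ≤
      K * ∑ i, |d i * x i| ^ r := by
  classical
  have hex : ∀ i : Fin k, ∃ j : Fin k, K ≤ (i : ℕ) → ((j : ℕ) / K + 1 = i / K ∧ ellNorm ∞
      (fun j : Fin k => (if (j : ℕ) / K + 1 = i / K then 1 else 0) * x j) ≤ |x j|) := fun i => by
    by_cases hi : K ≤ (i : ℕ)
    · have hne : (Finset.univ.filter fun j : Fin k => (j : ℕ) / K + 1 = i / K).Nonempty :=
        Finset.card_pos.1 (hK.trans_le (card_block_ge i hi hK))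
      obtain ⟨j, hj, hmax⟩ := Finset.exists_max_image _ (fun j => |x j|) hne
      refine ⟨j, fun _ => ⟨by simpa using hj, ?_⟩⟩
      rw [ellNorm_top]
      refine Real.iSup_le (fun l => ?_) (abs_nonneg _)
      split_ifs with hl
      · rw [one_mul]
        exact hmax l (by simpa using hl)
      · simp
    · exact ⟨i, fun h => absurd h hi⟩
  -- `σ i` is where the maximum over the previous block is attained. It precedes `i`, so `d i ≤ d (σ
  -- i)`; each fibre of `σ` lies in a single block and has at most `K` elements.
  choose σ hσ using hex
  have h1 : ∀ i : Fin k, (if K ≤ i then d i * ellNorm ∞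
      (fun j : Fin k => (if (j : ℕ) / K + 1 = i / K then 1 else 0) * x j) else 0) ^ r ≤
      if K ≤ (i : ℕ) then |d (σ i) * x (σ i)| ^ r else 0 := fun i => by
    split_ifs with hi
    · obtain ⟨ha, hb⟩ := hσ i hi
      have hlt : σ i ≤ i := by
        by_contra! hlt
        have := Nat.div_le_div_right (c := K) (Fin.lt_def.1 hlt).le
        omega
      refine Real.rpow_le_rpow (mul_nonneg (hd0 i) (ellNorm_nonneg le_top _)) ?_ hr.le
      rw [abs_mul, abs_of_nonneg (hd0 _)]
      exact mul_le_mul (hd hlt) hb (ellNorm_nonneg le_top _) (hd0 _)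
    · rw [Real.zero_rpow hr.ne']
  refine (Finset.sum_le_sum fun i _ => h1 i).trans ?_
  rw [← Finset.sum_filter, ← Finset.sum_fiberwise_of_maps_to
    (t := Finset.univ) (g := σ) (fun i _ => Finset.mem_univ _), Finset.mul_sum]
  refine Finset.sum_le_sum fun j _ => ?_
  have h2 : ∑ i ∈ (Finset.univ.filter fun i : Fin k => K ≤ (i : ℕ)).filter (fun i => σ i = j),
      |d (σ i) * x (σ i)| ^ r = ((Finset.univ.filter fun i : Fin k => K ≤ (i : ℕ)).filter
        (fun i => σ i = j)).card * |d j * x j| ^ r := by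
    rw [← nsmul_eq_mul, ← Finset.sum_const]
    refine Finset.sum_congr rfl fun i hi => ?_
    rw [(Finset.mem_filter.1 hi).2]
  rw [h2]
  refine mul_le_mul_of_nonneg_right ?_ (by positivity)
  have h3 := (Finset.card_le_card (s := (Finset.univ.filter fun i : Fin k => K ≤ (i : ℕ)).filter
    (fun i => σ i = j)) (t := Finset.univ.filter fun i : Fin k => (i : ℕ) / K = j / K + 1)
    (fun i hi => by
      simp only [Finset.mem_filter, Finset.mem_univ, true_and] at hi ⊢
      obtain ⟨hi1, rfl⟩ := hi
      exact (hσ i hi1).1.symm)).trans (card_block_le hK _)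
  exact_mod_cast h3

end Blocks

/-! ### Expected `ℓ_ρ` norms of Gaussian sequences. -/

section SplitNorm
variable {Ω : Type*} [MeasurableSpace Ω] {P : Measure Ω} [IsProbabilityMeasure P] {ρ : ℝ≥0∞}
  {k : ℕ} {g : Fin k → Ω → ℝ}

/-- Jensen's inequality for the weighted maxima of the preceding blocks. Each block has about `exp
r` independent variables, so its maximum has mean of order at least `√r`; passing from the sequence
to block maxima costs `K ^ (1 / r) ≤ e` by `sum_block_max_le`. -/
theorem tail_le_integral_ellNorm (hg : ∀ i, HasLaw (g i) (gaussianReal 0 1) P)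
    (hind : iIndepFun g P) (h : 1 ≤ ρ) (ht : ρ ≠ ∞) (d : Fin k → ℝ)
    (hd : Antitone d) (hd0 : ∀ i, 0 ≤ d i) :
    (Real.exp (-1) * (1 - Real.exp (-(gaussTail / 2)))) *
      (Real.sqrt ρ.toReal * ellNorm ρ ((headSet k ρ)ᶜ.indicator d)) ≤
      ∫ ω, ellNorm ρ (fun i => d i * g i ω) ∂P := by
  classical
  have hr := one_le_toReal h ht
  set r := ρ.toReal with hrdef
  have h0 : 0 < r := by linarith
  set K := ⌊Real.exp r⌋₊ with hKdef
  have hexp : 2 ≤ Real.exp r := by linarith [Real.add_one_le_exp r]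
  have hK : 0 < K := Nat.floor_pos.2 (by linarith)
  have hKle : (K : ℝ) ≤ Real.exp r := Nat.floor_le (by positivity)
  have hKge : Real.exp r / 2 ≤ K := by
    have := Nat.lt_floor_add_one (Real.exp r)
    rw [← hKdef] at this
    linarith
  set κ := 1 - Real.exp (-(gaussTail / 2)) with hκ
  have hκ0 : 0 ≤ κ := by
    rw [hκ, sub_nonneg, Real.exp_le_one_iff, neg_nonpos]
    exact (half_pos gaussTail_pos).le
  set J : Fin k → Fin k → ℝ := fun i j => if (j : ℕ) / K + 1 = i / K then 1 else 0 with hJ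
  set M : Fin k → Ω → ℝ := fun i ω => ellNorm ∞ (fun j => J i j * g j ω) with hM
  have hMint : ∀ i, Integrable (M i) P := fun i => integrable_ellNorm_gaussian hg le_top (J i)
  -- Each variable exceeds `√r` with probability at least `gaussTail * exp (-r)`, and a full block
  -- has at least `exp r / 2` variables.
  have hEM : ∀ i : Fin k, K ≤ (i : ℕ) → Real.sqrt r * κ ≤ ∫ ω, M i ω ∂P := fun i hi => by
    refine mul_one_sub_exp_le_integral_ellNorm_top hg hind (J i) (Real.sqrt_nonneg r) ?_
    calc gaussTail / 2 = gaussTail * Real.exp (-r) * (Real.exp r / 2) := by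
          rw [Real.exp_neg]; field_simp
      _ ≤ gaussTail * Real.exp (-r) *
          (Finset.univ.filter fun j : Fin k => (j : ℕ) / K + 1 = i / K).card := by
          refine mul_le_mul_of_nonneg_left ?_ (mul_pos gaussTail_pos (Real.exp_pos _)).le
          refine hKge.trans ?_
          exact_mod_cast card_block_ge i hi hK
      _ = ∑ j ∈ Finset.univ.filter fun j : Fin k => (j : ℕ) / K + 1 = i / K,
          gaussTail * Real.exp (-r) := by
          rw [Finset.sum_const, nsmul_eq_mul, mul_comm]
      _ ≤ ∑ j ∈ Finset.univ.filter fun j : Fin k => (j : ℕ) / K + 1 = i / K,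
          (gaussianReal 0 1).real {x | Real.sqrt r ≤ |J i j * x|} := by
          refine Finset.sum_le_sum fun j hj => ?_
          have hj' : J i j = 1 := if_pos (Finset.mem_filter.1 hj).2
          have := gaussTail_mul_exp_le_of_ne_zero (c := J i j)
            (by rw [hj']; exact one_ne_zero) (Real.sqrt r)
          refine le_trans (le_of_eq ?_) this
          rw [hj', abs_one, div_one, Real.sq_sqrt h0.le]
      _ ≤ _ := Finset.sum_le_sum_of_subset_of_nonneg (Finset.filter_subset _ _)
          fun _ _ _ => measureReal_nonneg
  set f : Fin k → Ω → ℝ := fun i ω => if K ≤ (i : ℕ) then d i * M i ω else 0 with hf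
  have hfint : ∀ i, Integrable (f i) P := fun i => by
    simp only [hf]
    split_ifs
    · exact (hMint i).const_mul _
    · exact integrable_zero _ _ _
  have hfn : ∀ i ω, 0 ≤ f i ω := fun i ω => by
    simp only [hf]
    split_ifs
    · exact mul_nonneg (hd0 i) (ellNorm_nonneg le_top _)
    · exact le_rfl
  have hpt : ∀ ω, ellNorm ρ (fun i => f i ω) ≤
      Real.exp 1 * ellNorm ρ (fun i => d i * g i ω) := fun ω => by
    have hb := sum_block_max_le hK h0 d (fun i => g i ω) hd hd0
    rw [ellNorm_eq_rpow h0, ellNorm_eq_rpow h0]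
    simp only [abs_of_nonneg (hfn _ ω)]
    have hS : 0 ≤ ∑ i, |d i * g i ω| ^ r := Finset.sum_nonneg fun i _ => by positivity
    calc (∑ i, f i ω ^ r) ^ (1 / r) ≤ (Real.exp r * ∑ i, |d i * g i ω| ^ r) ^ (1 / r) := by
          refine Real.rpow_le_rpow (Finset.sum_nonneg fun i _ =>
            Real.rpow_nonneg (hfn i ω) _) ?_ (by positivity)
          exact hb.trans (mul_le_mul_of_nonneg_right hKle hS)
      _ = _ := by
          rw [Real.mul_rpow (Real.exp_pos _).le hS, ← Real.exp_mul, mul_one_div_cancel h0.ne']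
  have hE := (ellNorm_integral_le h hfint).trans (integral_mono (integrable_ellNorm h hfint)
    ((integrable_ellNorm_gaussian hg h d).const_mul _) hpt)
  rw [integral_const_mul] at hE
  have hlow : Real.sqrt r * κ * ellNorm ρ ((headSet k ρ)ᶜ.indicator d) ≤
      ellNorm ρ (fun i => ∫ ω, f i ω ∂P) := by
    rw [← abs_of_nonneg (mul_nonneg (Real.sqrt_nonneg r) hκ0), ← ellNorm_smul h]
    refine ellNorm_mono h fun i => ?_
    rw [abs_of_nonneg (integral_nonneg (hfn i)), Pi.smul_apply, smul_eq_mul]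
    by_cases hi : i ∈ headSet k ρ
    · rw [Set.indicator_of_notMem (by simpa using hi), mul_zero, abs_zero]
      exact integral_nonneg (hfn i)
    · rw [Set.indicator_of_mem (by simpa using hi), abs_of_nonneg
        (mul_nonneg (mul_nonneg (Real.sqrt_nonneg r) hκ0) (hd0 i))]
      -- Positions are `i + 1`, so lying outside the head means `⌊exp r⌋₊ < i + 1`.
      have hKi : K ≤ (i : ℕ) := by
        simp only [headSet, Set.mem_ofPred_eq, ht, false_or, not_le] at hi
        have : ⌊Real.exp r⌋₊ < (i : ℕ) + 1 :=
          (Nat.floor_lt (Real.exp_pos _).le).2 (by exact_mod_cast hi)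
        omega
      simp only [hf, if_pos hKi]
      rw [integral_const_mul, mul_comm]
      exact mul_le_mul_of_nonneg_left (hEM i hKi) (hd0 i)
  have hfin := hlow.trans hE
  have he : Real.exp (-1) * Real.exp 1 = 1 := by rw [← Real.exp_add]; simp
  calc _ = Real.exp (-1) * (Real.sqrt r * κ * ellNorm ρ ((headSet k ρ)ᶜ.indicator d)) := by ring
    _ ≤ Real.exp (-1) * (Real.exp 1 * ∫ ω, ellNorm ρ (fun i => d i * g i ω) ∂P) := by gcongr
    _ = _ := by rw [← mul_assoc, he, one_mul]

/-- There are at most `exp ρ` nonzero entries, and `(exp ρ) ^ (1 / ρ) = e`. -/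
theorem ellNorm_head_le (h : 1 ≤ ρ) (x : Fin k → ℝ) (hx : ∀ i, i ∉ headSet k ρ → x i = 0) :
    ellNorm ρ x ≤ Real.exp 1 * ellNorm ∞ x := by
  classical
  have hn := ellNorm_nonneg le_top x
  by_cases ht : ρ = ∞
  · rw [ht]
    exact le_mul_of_one_le_left hn (Real.one_le_exp zero_le_one)
  · have hr := one_le_toReal h ht
    set r := ρ.toReal with hrdef
    have h0 : 0 < r := by linarith
    have hcard : ((Finset.univ.filter fun i => i ∈ headSet k ρ).card : ℝ) ≤ Real.exp r := by
      have h1 := Finset.card_le_card_of_injOn (s := Finset.univ.filter fun i => i ∈ headSet k ρ)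
        (t := Finset.range ⌊Real.exp r⌋₊) (fun i : Fin k => (i : ℕ)) (fun i hi => by
          simp only [headSet, Set.mem_ofPred_eq, ht, false_or, Finset.coe_filter, Finset.mem_univ,
            true_and] at hi
          simp only [Finset.coe_range, Set.mem_Iio]
          rw [← Nat.add_one_le_iff]
          exact Nat.le_floor (by exact_mod_cast hi))
        (fun i _ j _ hij => Fin.ext hij)
      rw [Finset.card_range] at h1
      exact (Nat.cast_le.2 h1).trans (Nat.floor_le (Real.exp_pos _).le)
    rw [ellNorm_eq_rpow h0]
    have hS : ∑ i, |x i| ^ r ≤ Real.exp r * ellNorm ∞ x ^ r := by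
      calc ∑ i, |x i| ^ r = ∑ i ∈ Finset.univ.filter fun i => i ∈ headSet k ρ, |x i| ^ r := by
            rw [Finset.sum_filter]
            refine Finset.sum_congr rfl fun i _ => ?_
            split_ifs with hi
            · rfl
            · rw [hx i hi, abs_zero, Real.zero_rpow h0.ne']
        _ ≤ ∑ i ∈ Finset.univ.filter fun i => i ∈ headSet k ρ, ellNorm ∞ x ^ r :=
            Finset.sum_le_sum fun i _ =>
              Real.rpow_le_rpow (abs_nonneg _) (abs_le_ellNorm le_top x i) h0.le
        _ ≤ _ := by
            rw [Finset.sum_const, nsmul_eq_mul]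
            exact mul_le_mul_of_nonneg_right hcard (by positivity)
    refine (Real.rpow_le_rpow (Finset.sum_nonneg fun i _ => by positivity) hS
      (by positivity)).trans (le_of_eq ?_)
    rw [Real.mul_rpow (Real.exp_pos _).le (by positivity), ← Real.exp_mul, ← Real.rpow_mul hn,
      mul_one_div_cancel h0.ne', Real.rpow_one]

theorem ellNorm_comp_equiv (h : 1 ≤ ρ) {ι : Type*} [Fintype ι] (e : ι ≃ ι) (x : ι → ℝ) :
    ellNorm ρ (fun i => x (e i)) = ellNorm ρ x := by
  by_cases ht : ρ = ∞
  · subst ht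
    rw [ellNorm_top, ellNorm_top]
    exact e.iSup_comp (g := fun i => |x i|)
  · have h0 : 0 < ρ.toReal := by linarith [one_le_toReal h ht]
    rw [ellNorm_eq_rpow h0, ellNorm_eq_rpow h0, e.sum_comp fun i => |x i| ^ ρ.toReal]

theorem ellNorm_top_le (h : 1 ≤ ρ) {ι : Type*} [Fintype ι] (x : ι → ℝ) :
    ellNorm ∞ x ≤ ellNorm ρ x := by
  rw [ellNorm_top]
  exact Real.iSup_le (fun i => abs_le_ellNorm h x i) (ellNorm_nonneg h x)

theorem antitone_decRearr (c : Fin k → ℝ) : Antitone (decRearr c) := fun i j hij => by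
  have := Tuple.monotone_sort (fun j => -|c j|) hij
  simpa [decRearr] using this

theorem ellNorm_mul_eq_decRearr (h : 1 ≤ ρ) (c x : Fin k → ℝ) :
    ellNorm ρ (fun i => c i * x i) =
      ellNorm ρ (fun i => decRearr c i * x (Tuple.sort (fun j => -|c j|) i)) := by
  rw [← ellNorm_comp_equiv h (Tuple.sort fun j => -|c j|)]
  exact ellNorm_congr_abs h fun i => by simp [decRearr, abs_mul]

/-- The constant in the upper bound of Gaussian sequences by `splitNorm`. -/
noncomputable def splitUpper : ℝ := Real.exp 1 * (3 + gaussExp) + 4 * gaussExp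

/-- The constant in the lower bound of Gaussian sequences by `splitNorm`. -/
noncomputable def splitLower : ℝ :=
  min (1 - Real.exp (-(gaussTail * Real.exp (-2))))
    (Real.exp (-1) * (1 - Real.exp (-(gaussTail / 2)))) / 2

theorem splitLower_pos : 0 < splitLower := by
  have h : ∀ x : ℝ, 0 < x → 0 < 1 - Real.exp (-x) := fun x hx => by
    rw [sub_pos, Real.exp_lt_one_iff]; linarith
  refine half_pos (lt_min (h _ (mul_pos gaussTail_pos (Real.exp_pos _)))
    (mul_pos (Real.exp_pos _) (h _ (half_pos gaussTail_pos))))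

/-- Triangle inequality for head and tail: the head is controlled by its maximum, the tail by
Gaussian moments. -/
theorem integral_ellNorm_le_splitNorm (hg : ∀ i, HasLaw (g i) (gaussianReal 0 1) P)
    (h : 1 ≤ ρ) (c : Fin k → ℝ) :
    ∫ ω, ellNorm ρ (fun i => c i * g i ω) ∂P ≤ splitUpper * splitNorm ρ c := by
  have hG := one_le_gaussExp
  set d := decRearr c
  set g' : Fin k → Ω → ℝ := fun i => g (Tuple.sort (fun j => -|c j|) i)
  have hg' : ∀ i, HasLaw (g' i) (gaussianReal 0 1) P := fun i => hg _
  set H := (headSet k ρ).indicator d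
  set T := (headSet k ρ)ᶜ.indicator d
  have h1 : ∀ ω, ellNorm ρ (fun i => c i * g i ω) ≤
      Real.exp 1 * ellNorm ∞ (fun i => H i * g' i ω) + ellNorm ρ (fun i => T i * g' i ω) := by
    intro ω
    rw [ellNorm_mul_eq_decRearr h c fun i => g i ω]
    have e : (fun i => decRearr c i * g (Tuple.sort (fun j => -|c j|) i) ω) =
        (fun i => H i * g' i ω) + fun i => T i * g' i ω := by
      ext i
      rw [Pi.add_apply, ← add_mul]
      congr 1
      exact (congrFun (Set.indicator_self_add_compl (headSet k ρ) d) i).symm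
    rw [e]
    refine (ellNorm_add_le h _ _).trans (add_le_add (ellNorm_head_le h _ fun i hi => ?_) le_rfl)
    simp only [H, Set.indicator_of_notMem hi, zero_mul]
  have iH := integrable_ellNorm_gaussian hg' (ρ := ∞) le_top H
  have iT := integrable_ellNorm_gaussian hg' h T
  have h2 : ∫ ω, ellNorm ρ (fun i => c i * g i ω) ∂P ≤
      Real.exp 1 * ∫ ω, ellNorm ∞ (fun i => H i * g' i ω) ∂P +
        ∫ ω, ellNorm ρ (fun i => T i * g' i ω) ∂P := by
    rw [← integral_const_mul, ← integral_add (iH.const_mul _) iT]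
    exact integral_mono (integrable_ellNorm_gaussian hg h c) ((iH.const_mul _).add iT) h1
  have h3 := integral_ellNorm_top_le_orliczNorm hg' H
  have h4 : ∫ ω, ellNorm ρ (fun i => T i * g' i ω) ∂P ≤
      4 * gaussExp * (Real.sqrt ρ.toReal * ellNorm ρ T) := by
    by_cases ht : ρ = ∞
    · have hT : T = 0 := by
        ext i
        refine Set.indicator_of_notMem ?_ _
        simp [headSet, ht]
      simp_rw [hT]
      simp only [Pi.zero_apply, zero_mul]
      change ∫ ω, ellNorm ρ (0 : Fin k → ℝ) ∂P ≤ _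
      simp [ellNorm_zero h]
    · exact integral_ellNorm_gaussian_le hg' h ht T
  have nH := orliczNorm_nonneg 2 H
  have nT : 0 ≤ Real.sqrt ρ.toReal * ellNorm ρ T :=
    mul_nonneg (Real.sqrt_nonneg _) (ellNorm_nonneg h T)
  change _ ≤ splitUpper * (orliczNorm 2 H + Real.sqrt ρ.toReal * ellNorm ρ T)
  have h5 : Real.exp 1 * ∫ ω, ellNorm ∞ (fun i => H i * g' i ω) ∂P ≤
      Real.exp 1 * ((3 + gaussExp) * orliczNorm 2 H) :=
    mul_le_mul_of_nonneg_left h3 (Real.exp_pos _).le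
  have h6 : 0 ≤ Real.exp 1 * (3 + gaussExp) := by positivity
  rw [splitUpper]
  nlinarith [mul_nonneg h6 nT, mul_nonneg (by positivity : 0 ≤ 4 * gaussExp) nH]

/-- Head and tail terms are each bounded by the same expectation, and half the smaller constant
absorbs their sum. Sorting only permutes the variables, which keeps their laws and independence. -/
theorem splitNorm_le_integral_ellNorm (hg : ∀ i, HasLaw (g i) (gaussianReal 0 1) P)
    (hind : iIndepFun g P) (h : 1 ≤ ρ) (c : Fin k → ℝ) :
    splitLower * splitNorm ρ c ≤ ∫ ω, ellNorm ρ (fun i => c i * g i ω) ∂P := by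
  set d := decRearr c with hd
  set g' : Fin k → Ω → ℝ := fun i => g (Tuple.sort (fun j => -|c j|) i)
  have hg' : ∀ i, HasLaw (g' i) (gaussianReal 0 1) P := fun i => hg _
  have hind' : iIndepFun g' P := hind.precomp (Tuple.sort (fun j => -|c j|)).injective
  have hd0 : ∀ i, 0 ≤ d i := fun i => abs_nonneg _
  set H := (headSet k ρ).indicator d
  set T := (headSet k ρ)ᶜ.indicator d
  have e : (fun ω => ellNorm ρ (fun i => c i * g i ω)) =
      fun ω => ellNorm ρ (fun i => d i * g' i ω) := by
    ext ω
    exact ellNorm_mul_eq_decRearr h c fun i => g i ω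
  rw [e]
  set I := ∫ ω, ellNorm ρ (fun i => d i * g' i ω) ∂P
  have h1 : (1 - Real.exp (-(gaussTail * Real.exp (-2)))) * orliczNorm 2 H ≤ I := by
    refine (mul_orliczNorm_le_integral hg' hind' H).trans ?_
    refine integral_mono (integrable_ellNorm_gaussian hg' le_top H)
      (integrable_ellNorm_gaussian hg' h d) fun ω => (ellNorm_top_le h _).trans ?_
    refine ellNorm_mono h fun i => ?_
    rw [abs_mul, abs_mul]
    refine mul_le_mul_of_nonneg_right ?_ (abs_nonneg _)
    by_cases hi : i ∈ headSet k ρ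
    · simp only [H, Set.indicator_of_mem hi, le_refl]
    · simp only [H, Set.indicator_of_notMem hi, abs_zero]
      exact abs_nonneg _
  have h2 : (Real.exp (-1) * (1 - Real.exp (-(gaussTail / 2)))) *
      (Real.sqrt ρ.toReal * ellNorm ρ T) ≤ I := by
    by_cases ht : ρ = ∞
    -- Here the convention `∞.toReal = 0` makes the tail term vanish.
    · rw [ht, ENNReal.toReal_top, Real.sqrt_zero, zero_mul, mul_zero]
      exact integral_nonneg fun ω => ellNorm_nonneg h _
    · exact tail_le_integral_ellNorm hg' hind' h ht d (antitone_decRearr c) hd0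
  have nH := orliczNorm_nonneg 2 H
  have nT : 0 ≤ Real.sqrt ρ.toReal * ellNorm ρ T :=
    mul_nonneg (Real.sqrt_nonneg _) (ellNorm_nonneg h T)
  change splitLower * (orliczNorm 2 H + Real.sqrt ρ.toReal * ellNorm ρ T) ≤ I
  have h3 := (mul_le_mul_of_nonneg_right (min_le_left (1 - Real.exp (-(gaussTail * Real.exp (-2))))
    (Real.exp (-1) * (1 - Real.exp (-(gaussTail / 2))))) nH).trans h1
  have h4 := (mul_le_mul_of_nonneg_right (min_le_right (1 - Real.exp (-(gaussTail * Real.exp (-2))))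
    (Real.exp (-1) * (1 - Real.exp (-(gaussTail / 2))))) nT).trans h2
  rw [splitLower]
  linarith

/-- The order of magnitude of `𝔼 ‖(c_i g_i)‖_ρ`. -/
noncomputable def gaussSeqNorm (ρ : ℝ≥0∞) (c : Fin k → ℝ) : ℝ :=
  if ρ < 2 then ellNorm ρ c else splitNorm ρ c

theorem integral_ellNorm_le_gaussSeqNorm (hg : ∀ i, HasLaw (g i) (gaussianReal 0 1) P)
    (h : 1 ≤ ρ) (c : Fin k → ℝ) :
    ∫ ω, ellNorm ρ (fun i => c i * g i ω) ∂P ≤ (splitUpper + 8 * gaussExp) * gaussSeqNorm ρ c := by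
  have hG := one_le_gaussExp
  have hU : 0 ≤ splitUpper := by unfold splitUpper; positivity
  unfold gaussSeqNorm
  split_ifs with h2
  · have ht : ρ ≠ ∞ := ne_top_of_lt h2
    have hr : ρ.toReal ≤ 2 := by simpa using ENNReal.toReal_mono (by simp) h2.le
    have hs : Real.sqrt ρ.toReal ≤ 2 := by
      rw [Real.sqrt_le_left (by norm_num)]; linarith
    have hn := ellNorm_nonneg h c
    refine (integral_ellNorm_gaussian_le hg h ht c).trans ?_
    calc 4 * gaussExp * (Real.sqrt ρ.toReal * ellNorm ρ c)
        ≤ 4 * gaussExp * (2 * ellNorm ρ c) := by gcongr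
      _ = 8 * gaussExp * ellNorm ρ c := by ring
      _ ≤ _ := mul_le_mul_of_nonneg_right (le_add_of_nonneg_left hU) hn
  · have hn : 0 ≤ splitNorm ρ c := add_nonneg (orliczNorm_nonneg _ _)
      (mul_nonneg (Real.sqrt_nonneg _) (ellNorm_nonneg h _))
    refine (integral_ellNorm_le_splitNorm hg h c).trans ?_
    exact mul_le_mul_of_nonneg_right (le_add_of_nonneg_right (by positivity)) hn

theorem gaussSeqNorm_le_integral_ellNorm (hg : ∀ i, HasLaw (g i) (gaussianReal 0 1) P)
    (hind : iIndepFun g P) (h : 1 ≤ ρ) (c : Fin k → ℝ) :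
    min splitLower (gaussTail * Real.exp (-1)) * gaussSeqNorm ρ c ≤
      ∫ ω, ellNorm ρ (fun i => c i * g i ω) ∂P := by
  unfold gaussSeqNorm
  split_ifs with h2
  · exact (mul_le_mul_of_nonneg_right (min_le_right _ _) (ellNorm_nonneg h c)).trans
      (ellNorm_le_integral_gaussian hg h c)
  · have hn : 0 ≤ splitNorm ρ c := add_nonneg (orliczNorm_nonneg _ _)
      (mul_nonneg (Real.sqrt_nonneg _) (ellNorm_nonneg h _))
    exact (mul_le_mul_of_nonneg_right (min_le_left _ _) hn).trans
      (splitNorm_le_integral_ellNorm hg hind h c)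

end SplitNorm

/-! ### The operator norm as a function of the matrix. -/

section OperatorNorm
variable {m n : ℕ} {p q ps qs : ℝ≥0∞}

/-- Multiplication by a matrix as a continuous linear map between `ℓ_p` and `ℓ_q`. -/
noncomputable def mulVecCLM (p q : ℝ≥0∞) [Fact (1 ≤ p)] [Fact (1 ≤ q)] :
    (Fin m → Fin n → ℝ) →ₗ[ℝ]
      (PiLp p (fun _ : Fin n => ℝ) →L[ℝ] PiLp q (fun _ : Fin m => ℝ)) where
  toFun X := LinearMap.toContinuousLinearMap
    ((WithLp.linearEquiv q ℝ (Fin m → ℝ)).symm.toLinearMap ∘ₗ (Matrix.of X).mulVecLin ∘ₗ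
      (WithLp.linearEquiv p ℝ (Fin n → ℝ)).toLinearMap)
  map_add' X Y := by
    ext t i
    simp [Matrix.mulVec, dotProduct, add_mul, Finset.sum_add_distrib]
  map_smul' c X := by
    ext t i
    simp [Matrix.mulVec, dotProduct, mul_assoc, Finset.mul_sum]

theorem ellNorm_mulVec_le_opNormLpLq (hp : 1 ≤ p) (hq : 1 ≤ q) (X : Matrix (Fin m) (Fin n) ℝ)
    {t : Fin n → ℝ} (ht : ellNorm p t ≤ 1) : ellNorm q (X.mulVec t) ≤ opNormLpLq p q X := by
  have : Fact (1 ≤ p) := ⟨hp⟩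
  have : Fact (1 ≤ q) := ⟨hq⟩
  refine le_ciSup (f := fun t : {t : Fin n → ℝ // ellNorm p t ≤ 1} => ellNorm q (X.mulVec t.1))
    ⟨‖mulVecCLM p q X‖, ?_⟩ ⟨t, ht⟩
  rintro _ ⟨s, rfl⟩
  exact ((mulVecCLM p q X).le_opNorm (WithLp.toLp p s.1)).trans
    (mul_le_of_le_one_right (norm_nonneg _) s.2)

theorem opNormLpLq_le (hp : 1 ≤ p) {X : Matrix (Fin m) (Fin n) ℝ} {C : ℝ}
    (h : ∀ t, ellNorm p t ≤ 1 → ellNorm q (X.mulVec t) ≤ C) : opNormLpLq p q X ≤ C := by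
  have : Nonempty {t : Fin n → ℝ // ellNorm p t ≤ 1} :=
    ⟨⟨0, by rw [ellNorm_zero hp]; exact zero_le_one⟩⟩
  exact ciSup_le fun t => h t.1 t.2

theorem opNormLpLq_nonneg (hp : 1 ≤ p) (hq : 1 ≤ q) (X : Matrix (Fin m) (Fin n) ℝ) :
    0 ≤ opNormLpLq p q X :=
  (ellNorm_nonneg hq _).trans
    (ellNorm_mulVec_le_opNormLpLq hp hq X (t := 0) (by rw [ellNorm_zero hp]; exact zero_le_one))

theorem opNormLpLq_eq_norm [Fact (1 ≤ p)] [Fact (1 ≤ q)] (X : Fin m → Fin n → ℝ) :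
    opNormLpLq p q (Matrix.of X) = ‖mulVecCLM p q X‖ := by
  have hp : 1 ≤ p := Fact.out
  have hq : 1 ≤ q := Fact.out
  refine le_antisymm (opNormLpLq_le hp fun t ht => ?_) ?_
  · exact ((mulVecCLM p q X).le_opNorm (WithLp.toLp p t)).trans
      (mul_le_of_le_one_right (norm_nonneg _) ht)
  · refine ContinuousLinearMap.opNorm_le_of_unit_norm (opNormLpLq_nonneg hp hq _) fun t ht => ?_
    exact ellNorm_mulVec_le_opNormLpLq hp hq (Matrix.of X) (t := t.ofLp) ht.le

theorem continuous_opNormLpLq (hp : 1 ≤ p) (hq : 1 ≤ q) :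
    Continuous fun X : Fin m → Fin n → ℝ => opNormLpLq p q (Matrix.of X) := by
  have : Fact (1 ≤ p) := ⟨hp⟩
  have : Fact (1 ≤ q) := ⟨hq⟩
  simp only [opNormLpLq_eq_norm]
  exact continuous_norm.comp (LinearMap.continuous_of_finiteDimensional (mulVecCLM p q))

/-- The operator norm is a norm composed with a linear map of the entries, hence dominated by a
constant multiple of the sum of their absolute values. -/
theorem integrable_opNormLpLq {Ω : Type*} [MeasurableSpace Ω] {P : Measure Ω} (hp : 1 ≤ p)
    (hq : 1 ≤ q) {f : Fin m → Fin n → Ω → ℝ} (hf : ∀ i j, Integrable (f i j) P) :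
    Integrable (fun ω => opNormLpLq p q (Matrix.of fun i j => f i j ω)) P := by
  have : Fact (1 ≤ p) := ⟨hp⟩
  have : Fact (1 ≤ q) := ⟨hq⟩
  set L := LinearMap.toContinuousLinearMap
    (mulVecCLM p q : (Fin m → Fin n → ℝ) →ₗ[ℝ] _) with hL
  have hs : Integrable (fun ω => ‖L‖ * ∑ i, ∑ j, |f i j ω|) P :=
    (integrable_finsetSum _ fun i _ => integrable_finsetSum _ fun j _ => (hf i j).abs).const_mul _
  refine hs.mono' ?_ (.of_forall fun ω => ?_)
  · exact (continuous_opNormLpLq hp hq).comp_aestronglyMeasurable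
      (aemeasurable_pi_lambda _ fun i =>
        aemeasurable_pi_lambda _ fun j => (hf i j).aemeasurable).aestronglyMeasurable
  · rw [Real.norm_eq_abs, abs_of_nonneg (opNormLpLq_nonneg hp hq _), opNormLpLq_eq_norm]
    refine (L.le_opNorm _).trans (mul_le_mul_of_nonneg_left ?_ (norm_nonneg _))
    have hn : 0 ≤ ∑ i, ∑ j, |f i j ω| :=
      Finset.sum_nonneg fun i _ => Finset.sum_nonneg fun j _ => abs_nonneg _
    refine (pi_norm_le_iff_of_nonneg hn).2 fun i => (pi_norm_le_iff_of_nonneg hn).2 fun j => ?_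
    exact (Finset.single_le_sum (f := fun j => |f i j ω|) (fun _ _ => abs_nonneg _)
      (Finset.mem_univ j)).trans (Finset.single_le_sum (f := fun i => ∑ j, |f i j ω|)
        (fun _ _ => Finset.sum_nonneg fun _ _ => abs_nonneg _) (Finset.mem_univ i))

theorem dotProduct_mulVec_le_opNormLpLq (hp : 1 ≤ p) (h : q.HolderConjugate qs)
    (X : Matrix (Fin m) (Fin n) ℝ) {s : Fin m → ℝ} {t : Fin n → ℝ} (hs : ellNorm qs s ≤ 1)
    (ht : ellNorm p t ≤ 1) : X.mulVec t ⬝ᵥ s ≤ opNormLpLq p q X := by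
  have hq : 1 ≤ q := ENNReal.HolderConjugate.one_le q qs
  exact (dotProduct_le_ellNorm_mul h _ s).trans ((mul_le_of_le_one_right
    (ellNorm_nonneg hq _) hs).trans (ellNorm_mulVec_le_opNormLpLq hp hq X ht))

/-- Norming sets of the two spaces norm the operators between them. -/
theorem exists_opNormLpLq_le (h : ps.HolderConjugate p) {S : Finset (Fin m → ℝ)}
    {T : Finset (Fin n → ℝ)} (hSne : S.Nonempty) (hTne : T.Nonempty)
    (hS : ∀ x : Fin m → ℝ, ∃ s ∈ S, ellNorm q x ≤ 2 * (x ⬝ᵥ s))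
    (hT : ∀ x : Fin n → ℝ, ∃ t ∈ T, ellNorm ps x ≤ 2 * (x ⬝ᵥ t))
    (X : Matrix (Fin m) (Fin n) ℝ) :
    ∃ u : S × T, opNormLpLq p q X ≤ 4 * (X.mulVec u.2.1 ⬝ᵥ u.1.1) := by
  have hp : 1 ≤ p := ENNReal.HolderConjugate.one_le p ps
  have hps : 1 ≤ ps := ENNReal.HolderConjugate.one_le ps p
  have := hSne.to_subtype
  have := hTne.to_subtype
  -- One pair must serve every `t`, so the maximizing pair is taken. Norming `X t` by `s` and then
  -- `Xᵀ s` by `t'` costs a factor `2` each time.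
  obtain ⟨u, hu⟩ := Finite.exists_max fun u : S × T => X.mulVec u.2.1 ⬝ᵥ u.1.1
  refine ⟨u, opNormLpLq_le hp fun t ht => ?_⟩
  obtain ⟨s, hs, h1⟩ := hS (X.mulVec t)
  obtain ⟨t', ht', h2⟩ := hT (X.transpose.mulVec s)
  have e : ∀ v : Fin n → ℝ, X.mulVec v ⬝ᵥ s = X.transpose.mulVec s ⬝ᵥ v := fun v => by
    rw [Matrix.mulVec_transpose, ← Matrix.dotProduct_mulVec, dotProduct_comm]
  have h3 := dotProduct_le_ellNorm_mul h (X.transpose.mulVec s) t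
  have h4 := hu (⟨s, hs⟩, ⟨t', ht'⟩)
  have h5 := mul_le_of_le_one_right (ellNorm_nonneg hps (X.transpose.mulVec s)) ht
  simp only [e t'] at h4
  rw [e t] at h1
  linarith

end OperatorNorm

/-! ### Chevet's inequality in both directions. -/

section Chevet
variable {m n : ℕ} {p q ps qs : ℝ≥0∞} (a : Fin m → ℝ) (b : Fin n → ℝ)

/-- Index set of the Gaussian variables compared in Chevet's inequality: the matrix entries, and
one independent sequence for each of the two factors. -/
abbrev ChevetIndex (m n : ℕ) : Type := (Fin m × Fin n) ⊕ (Fin m ⊕ Fin n)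

/-- The matrix with entries `a i * b j * x i j`. -/
def tensorMatrix (x : ChevetIndex m n → ℝ) : Matrix (Fin m) (Fin n) ℝ :=
  Matrix.of fun i j => a i * b j * x (.inl (i, j))

/-- The coefficients of the matrix entries in the bilinear form of `tensorMatrix`. -/
def tensorCoeff (s : Fin m → ℝ) (t : Fin n → ℝ) : ChevetIndex m n → ℝ :=
  Sum.elim (fun ij => (a ij.1 * s ij.1) * (b ij.2 * t ij.2)) 0

/-- The coefficients of the two auxiliary Gaussian sequences. -/
def factorCoeff (v : Fin m → ℝ) (w : Fin n → ℝ) : ChevetIndex m n → ℝ :=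
  Sum.elim 0 (Sum.elim v w)

theorem tensorCoeff_dotProduct (s : Fin m → ℝ) (t : Fin n → ℝ) (x : ChevetIndex m n → ℝ) :
    tensorCoeff a b s t ⬝ᵥ x = (tensorMatrix a b x).mulVec t ⬝ᵥ s := by
  simp only [tensorCoeff, tensorMatrix, dotProduct, Fintype.sum_sum_type, Fintype.sum_prod_type,
    Sum.elim_inl, Sum.elim_inr, Pi.zero_apply, zero_mul, Finset.sum_const_zero, add_zero,
    Matrix.mulVec, Matrix.of_apply, Finset.sum_mul]
  exact Finset.sum_congr rfl fun i _ => Finset.sum_congr rfl fun j _ => by ring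

theorem factorCoeff_dotProduct (v : Fin m → ℝ) (w : Fin n → ℝ) (x : ChevetIndex m n → ℝ) :
    factorCoeff v w ⬝ᵥ x =
      (∑ i, v i * x (.inr (.inl i))) + ∑ j, w j * x (.inr (.inr j)) := by
  simp [factorCoeff, dotProduct]

theorem tensorCoeff_dotProduct_factorCoeff (s : Fin m → ℝ) (t : Fin n → ℝ) (v : Fin m → ℝ)
    (w : Fin n → ℝ) : tensorCoeff a b s t ⬝ᵥ factorCoeff v w = 0 := by
  simp [factorCoeff, tensorCoeff, dotProduct]

theorem factorCoeff_sub_dotProduct (v v' : Fin m → ℝ) (w w' : Fin n → ℝ) :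
    (factorCoeff v w - factorCoeff v' w') ⬝ᵥ (factorCoeff v w - factorCoeff v' w') =
      (∑ i, (v i - v' i) ^ 2) + ∑ j, (w j - w' j) ^ 2 := by
  simp [factorCoeff, dotProduct, pow_two]

theorem tensorCoeff_sub_dotProduct (s s' : Fin m → ℝ) (t t' : Fin n → ℝ) :
    (tensorCoeff a b s t - tensorCoeff a b s' t') ⬝ᵥ
      (tensorCoeff a b s t - tensorCoeff a b s' t') =
      ∑ i, ∑ j, ((a i * s i) * (b j * t j) - (a i * s' i) * (b j * t' j)) ^ 2 := by
  simp [tensorCoeff, dotProduct, Fintype.sum_prod_type, pow_two]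

theorem integrable_tensorMatrix (hp : 1 ≤ p) (hq : 1 ≤ q) :
    Integrable (fun x => opNormLpLq p q (tensorMatrix a b x)) (stdGauss (ChevetIndex m n)) :=
  integrable_opNormLpLq hp hq fun _ _ => (integrable_eval_stdGauss _).const_mul _

theorem integrable_left_factor (hq : 1 ≤ q) :
    Integrable (fun x : ChevetIndex m n → ℝ => ellNorm q fun i => a i * x (.inr (.inl i)))
      (stdGauss (ChevetIndex m n)) :=
  integrable_ellNorm hq fun _ => (integrable_eval_stdGauss _).const_mul _

theorem integrable_right_factor (hq : 1 ≤ q) :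
    Integrable (fun x : ChevetIndex m n → ℝ => ellNorm q fun j => b j * x (.inr (.inr j)))
      (stdGauss (ChevetIndex m n)) :=
  integrable_ellNorm hq fun _ => (integrable_eval_stdGauss _).const_mul _

/-- Chevet's inequality for the unit balls of `ℓ_p` and `ℓ_{q^*}`, up to a constant. -/
theorem chevet_upper (hps : ps.HolderConjugate p) (hqs : q.HolderConjugate qs) :
    ∫ x, opNormLpLq p q (tensorMatrix a b x) ∂(stdGauss (ChevetIndex m n)) ≤
      8 * (diagNorm p b * ∫ x : ChevetIndex m n → ℝ, ellNorm q (fun i => a i * x (.inr (.inl i)))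
          ∂(stdGauss (ChevetIndex m n)) +
        diagNorm qs a * ∫ x : ChevetIndex m n → ℝ, ellNorm ps (fun j => b j * x (.inr (.inr j)))
          ∂(stdGauss (ChevetIndex m n))) := by
  have hp1 : 1 ≤ p := ENNReal.HolderConjugate.one_le p ps
  have hq1 : 1 ≤ q := ENNReal.HolderConjugate.one_le q qs
  have hps1 : 1 ≤ ps := ENNReal.HolderConjugate.one_le ps p
  have hqs1 : 1 ≤ qs := ENNReal.HolderConjugate.one_le qs q
  obtain ⟨S, hSne, hS1, hS⟩ := exists_finset_norming (ι := Fin m) hqs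
  obtain ⟨T, hTne, hT1, hT⟩ := exists_finset_norming (ι := Fin n) hps
  have := hSne.to_subtype
  have := hTne.to_subtype
  set σ := diagNorm qs a
  set τ := diagNorm p b
  have hσ0 : 0 ≤ σ := diagNorm_nonneg a
  have hτ0 : 0 ≤ τ := diagNorm_nonneg b
  have iA := integrable_left_factor (n := n) a hq1
  have iB := integrable_right_factor (m := m) b hps1
  have key := sudakov_fernique (κ := S × T) (ι := ChevetIndex m n)
    (fun u => tensorCoeff a b u.1.1 u.2.1)
    -- The factors `2` absorb the constant in the increment bound, which comes from `x ⊗ y - x' ⊗ y'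
    -- = x ⊗ (y - y') + (x - x') ⊗ y'` and `(α + β)² ≤ 2α² + 2β²`.
    (fun u => factorCoeff (fun i => 2 * τ * (a i * u.1.1 i)) (fun j => 2 * σ * (b j * u.2.1 j)))
    (fun _ _ => tensorCoeff_dotProduct_factorCoeff a b _ _ _ _)
    (fun u v => by
      rw [tensorCoeff_sub_dotProduct, factorCoeff_sub_dotProduct]
      have h1 := sum_mul_sq_le_diagNorm hqs1 a u.1.1 (hS1 _ u.1.2)
      have h2 := sum_mul_sq_le_diagNorm hp1 b v.2.1 (hT1 _ v.2.2)
      have n1 : 0 ≤ ∑ j, (b j * u.2.1 j - b j * v.2.1 j) ^ 2 :=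
        Finset.sum_nonneg fun _ _ => sq_nonneg _
      have n2 : 0 ≤ ∑ i, (a i * u.1.1 i - a i * v.1.1 i) ^ 2 :=
        Finset.sum_nonneg fun _ _ => sq_nonneg _
      calc ∑ i, ∑ j, ((a i * u.1.1 i) * (b j * u.2.1 j) - (a i * v.1.1 i) * (b j * v.2.1 j)) ^ 2
          ≤ ∑ i, ∑ j, (2 * ((a i * u.1.1 i) ^ 2 * (b j * u.2.1 j - b j * v.2.1 j) ^ 2) +
            2 * ((a i * u.1.1 i - a i * v.1.1 i) ^ 2 * (b j * v.2.1 j) ^ 2)) := by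
            refine Finset.sum_le_sum fun i _ => Finset.sum_le_sum fun j _ => ?_
            nlinarith [sq_nonneg ((a i * u.1.1 i) * (b j * u.2.1 j - b j * v.2.1 j) -
              (a i * u.1.1 i - a i * v.1.1 i) * (b j * v.2.1 j))]
        _ = 2 * ((∑ i, (a i * u.1.1 i) ^ 2) * ∑ j, (b j * u.2.1 j - b j * v.2.1 j) ^ 2) +
            2 * ((∑ i, (a i * u.1.1 i - a i * v.1.1 i) ^ 2) * ∑ j, (b j * v.2.1 j) ^ 2) := by
            simp only [Finset.sum_add_distrib, ← Finset.mul_sum, Finset.sum_mul_sum]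
        _ ≤ 2 * (σ ^ 2 * ∑ j, (b j * u.2.1 j - b j * v.2.1 j) ^ 2) +
            2 * ((∑ i, (a i * u.1.1 i - a i * v.1.1 i) ^ 2) * τ ^ 2) := by gcongr
        _ ≤ (2 * τ) ^ 2 * (∑ i, (a i * u.1.1 i - a i * v.1.1 i) ^ 2) +
            (2 * σ) ^ 2 * ∑ j, (b j * u.2.1 j - b j * v.2.1 j) ^ 2 := by
            nlinarith [mul_nonneg (sq_nonneg σ) n1, mul_nonneg (sq_nonneg τ) n2]
        _ = _ := by
            rw [Finset.mul_sum, Finset.mul_sum]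
            congr 1 <;> exact Finset.sum_congr rfl fun _ _ => by ring)
    -- The `1 / 4` is the loss in `exists_opNormLpLq_le`; with the factor `2` above it gives the
    -- constant `8`.
    ((integrable_tensorMatrix a b hp1 hq1).const_mul (1 / 4))
    (((iA.const_mul τ).add (iB.const_mul σ)).const_mul 2)
    (fun x => by
      obtain ⟨u, hu⟩ := exists_opNormLpLq_le hps hSne hTne hS hT (tensorMatrix a b x)
      refine ⟨u, ?_⟩
      rw [tensorCoeff_dotProduct]
      linarith)
    (fun x u => by
      rw [factorCoeff_dotProduct]
      have h1 := (dotProduct_le_ellNorm_mul hqs (fun i => a i * x (.inr (.inl i))) u.1.1).trans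
        (mul_le_of_le_one_right (ellNorm_nonneg hq1 _) (hS1 _ u.1.2))
      have h2 := (dotProduct_le_ellNorm_mul hps (fun j => b j * x (.inr (.inr j))) u.2.1).trans
        (mul_le_of_le_one_right (ellNorm_nonneg hps1 _) (hT1 _ u.2.2))
      have e1 : ∑ i, 2 * τ * (a i * u.1.1 i) * x (.inr (.inl i)) =
          2 * (τ * ((fun i => a i * x (.inr (.inl i))) ⬝ᵥ u.1.1)) := by
        simp only [dotProduct, Finset.mul_sum]
        exact Finset.sum_congr rfl fun _ _ => by ring
      have e2 : ∑ j, 2 * σ * (b j * u.2.1 j) * x (.inr (.inr j)) =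
          2 * (σ * ((fun j => b j * x (.inr (.inr j))) ⬝ᵥ u.2.1)) := by
        simp only [dotProduct, Finset.mul_sum]
        exact Finset.sum_congr rfl fun _ _ => by ring
      rw [e1, e2]
      simp only [Pi.add_apply]
      have := mul_le_mul_of_nonneg_left h1 hτ0
      have := mul_le_mul_of_nonneg_left h2 hσ0
      linarith)
  rw [integral_const_mul, integral_const_mul] at key
  have e : ∫ x, ((fun x : ChevetIndex m n → ℝ => τ * ellNorm q fun i => a i * x (.inr (.inl i))) +
      fun x : ChevetIndex m n → ℝ => σ * ellNorm ps fun j => b j * x (.inr (.inr j))) x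
        ∂(stdGauss (ChevetIndex m n)) =
      τ * ∫ x : ChevetIndex m n → ℝ, ellNorm q (fun i => a i * x (.inr (.inl i)))
          ∂(stdGauss (ChevetIndex m n)) +
        σ * ∫ x : ChevetIndex m n → ℝ, ellNorm ps (fun j => b j * x (.inr (.inr j)))
          ∂(stdGauss (ChevetIndex m n)) := by
    rw [integral_add' (iA.const_mul τ) (iB.const_mul σ), integral_const_mul, integral_const_mul]
  rw [e] at key
  linarith

/-- Freeze `t` at the extremal vector of the diagonal operator. The matrix process in `s` alone then
has increments at least those of `diagNorm p b * ∑ a i * s i * g i`. -/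
theorem chevet_lower_left (hps : ps.HolderConjugate p) (hqs : q.HolderConjugate qs) :
    diagNorm p b * ∫ x : ChevetIndex m n → ℝ, ellNorm q (fun i => a i * x (.inr (.inl i)))
          ∂(stdGauss (ChevetIndex m n)) ≤
      2 * ∫ x, opNormLpLq p q (tensorMatrix a b x) ∂(stdGauss (ChevetIndex m n)) := by
  have hp1 : 1 ≤ p := ENNReal.HolderConjugate.one_le p ps
  have hq1 : 1 ≤ q := ENNReal.HolderConjugate.one_le q qs
  obtain ⟨S, hSne, hS1, hS⟩ := exists_finset_norming (ι := Fin m) hqs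
  obtain ⟨t, ht1, ht⟩ := exists_diagNorm_le_sum hp1 b
  have := hSne.to_subtype
  set τ := diagNorm p b
  have hτ0 : 0 ≤ τ := diagNorm_nonneg b
  have key := sudakov_fernique (κ := S) (ι := ChevetIndex m n)
    (fun u => factorCoeff (fun i => τ * (a i * u.1 i)) 0)
    (fun u => tensorCoeff a b u.1 t)
    (fun _ _ => by rw [dotProduct_comm, tensorCoeff_dotProduct_factorCoeff])
    (fun u v => by
      rw [tensorCoeff_sub_dotProduct, factorCoeff_sub_dotProduct]
      have e : ∑ i, ∑ j, ((a i * u.1 i) * (b j * t j) - (a i * v.1 i) * (b j * t j)) ^ 2 =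
          (∑ i, (a i * u.1 i - a i * v.1 i) ^ 2) * ∑ j, (b j * t j) ^ 2 := by
        rw [Finset.sum_mul_sum]
        exact Finset.sum_congr rfl fun _ _ => Finset.sum_congr rfl fun _ _ => by ring
      have e' : ∑ i, (τ * (a i * u.1 i) - τ * (a i * v.1 i)) ^ 2 =
          (∑ i, (a i * u.1 i - a i * v.1 i) ^ 2) * τ ^ 2 := by
        rw [Finset.sum_mul]
        exact Finset.sum_congr rfl fun _ _ => by ring
      rw [e, e']
      simp only [Pi.zero_apply, sub_zero, zero_pow two_ne_zero, Finset.sum_const_zero, add_zero]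
      exact mul_le_mul_of_nonneg_left ht (Finset.sum_nonneg fun _ _ => sq_nonneg _))
    ((integrable_left_factor (n := n) a hq1).const_mul (τ / 2))
    (integrable_tensorMatrix a b hp1 hq1)
    (fun x => by
      obtain ⟨s, hs, h⟩ := hS fun i => a i * x (.inr (.inl i))
      refine ⟨⟨s, hs⟩, ?_⟩
      rw [factorCoeff_dotProduct]
      have e1 : ∑ i, τ * (a i * s i) * x (.inr (.inl i)) =
          τ * ((fun i => a i * x (.inr (.inl i))) ⬝ᵥ s) := by
        simp only [dotProduct, Finset.mul_sum]
        exact Finset.sum_congr rfl fun _ _ => by ring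
      rw [e1]
      simp only [Pi.zero_apply, zero_mul, Finset.sum_const_zero, add_zero]
      nlinarith)
    (fun x u => by
      rw [tensorCoeff_dotProduct]
      exact dotProduct_mulVec_le_opNormLpLq hp1 hqs _ (hS1 _ u.2) ht1)
  rw [integral_const_mul] at key
  linarith

/-- The mirror image of `chevet_lower_left`, with `s` frozen and `t` varying. -/
theorem chevet_lower_right (hps : ps.HolderConjugate p) (hqs : q.HolderConjugate qs) :
    diagNorm qs a * ∫ x : ChevetIndex m n → ℝ, ellNorm ps (fun j => b j * x (.inr (.inr j)))
          ∂(stdGauss (ChevetIndex m n)) ≤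
      2 * ∫ x, opNormLpLq p q (tensorMatrix a b x) ∂(stdGauss (ChevetIndex m n)) := by
  have hp1 : 1 ≤ p := ENNReal.HolderConjugate.one_le p ps
  have hq1 : 1 ≤ q := ENNReal.HolderConjugate.one_le q qs
  have hps1 : 1 ≤ ps := ENNReal.HolderConjugate.one_le ps p
  have hqs1 : 1 ≤ qs := ENNReal.HolderConjugate.one_le qs q
  obtain ⟨T, hTne, hT1, hT⟩ := exists_finset_norming (ι := Fin n) hps
  obtain ⟨s, hs1, hs⟩ := exists_diagNorm_le_sum hqs1 a
  have := hTne.to_subtype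
  set σ := diagNorm qs a
  have hσ0 : 0 ≤ σ := diagNorm_nonneg a
  have key := sudakov_fernique (κ := T) (ι := ChevetIndex m n)
    (fun u => factorCoeff 0 (fun j => σ * (b j * u.1 j)))
    (fun u => tensorCoeff a b s u.1)
    (fun _ _ => by rw [dotProduct_comm, tensorCoeff_dotProduct_factorCoeff])
    (fun u v => by
      rw [tensorCoeff_sub_dotProduct, factorCoeff_sub_dotProduct]
      have e : ∑ i, ∑ j, ((a i * s i) * (b j * u.1 j) - (a i * s i) * (b j * v.1 j)) ^ 2 =
          (∑ i, (a i * s i) ^ 2) * ∑ j, (b j * u.1 j - b j * v.1 j) ^ 2 := by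
        rw [Finset.sum_mul_sum]
        exact Finset.sum_congr rfl fun _ _ => Finset.sum_congr rfl fun _ _ => by ring
      have e' : ∑ j, (σ * (b j * u.1 j) - σ * (b j * v.1 j)) ^ 2 =
          σ ^ 2 * ∑ j, (b j * u.1 j - b j * v.1 j) ^ 2 := by
        rw [Finset.mul_sum]
        exact Finset.sum_congr rfl fun _ _ => by ring
      rw [e, e']
      simp only [Pi.zero_apply, sub_zero, zero_pow two_ne_zero, Finset.sum_const_zero, zero_add]
      exact mul_le_mul_of_nonneg_right hs (Finset.sum_nonneg fun _ _ => sq_nonneg _))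
    ((integrable_right_factor (m := m) b hps1).const_mul (σ / 2))
    (integrable_tensorMatrix a b hp1 hq1)
    (fun x => by
      obtain ⟨t, ht, h⟩ := hT fun j => b j * x (.inr (.inr j))
      refine ⟨⟨t, ht⟩, ?_⟩
      rw [factorCoeff_dotProduct]
      have e1 : ∑ j, σ * (b j * t j) * x (.inr (.inr j)) =
          σ * ((fun j => b j * x (.inr (.inr j))) ⬝ᵥ t) := by
        simp only [dotProduct, Finset.mul_sum]
        exact Finset.sum_congr rfl fun _ _ => by ring
      rw [e1]
      simp only [Pi.zero_apply, zero_mul, Finset.sum_const_zero, zero_add]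
      nlinarith)
    (fun x u => by
      rw [tensorCoeff_dotProduct]
      exact dotProduct_mulVec_le_opNormLpLq hp1 hqs _ hs1 (hT1 _ u.2))
  rw [integral_const_mul] at key
  linarith

end Chevet

/-! ### Combining Chevet's inequality with the sequence estimates. -/

section Assembly

theorem iIndepFun_eval_stdGauss (ι : Type*) [Fintype ι] :
    iIndepFun (fun (i : ι) (x : ι → ℝ) => x i) (stdGauss ι) :=
  iIndepFun_pi (X := fun _ : ι => (id : ℝ → ℝ)) fun _ => aemeasurable_id

/-- The expectation depends only on the joint law of the entries, so it may be computed on the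
product space that also carries the two auxiliary sequences. -/
theorem integral_tensor_eq {m n : ℕ} {p q : ℝ≥0∞} (hp : 1 ≤ p) (hq : 1 ≤ q) (a : Fin m → ℝ)
    (b : Fin n → ℝ) {Ω : Type*} [MeasurableSpace Ω] {P : Measure Ω} {g : Fin m → Fin n → Ω → ℝ}
    (hg : ∀ i j, HasLaw (g i j) (gaussianReal 0 1) P)
    (hind : iIndepFun (fun ij : Fin m × Fin n => g ij.1 ij.2) P) :
    ∫ ω, opNormLpLq p q (Matrix.of fun i j => a i * b j * g i j ω) ∂P =
      ∫ x, opNormLpLq p q (tensorMatrix a b x) ∂(stdGauss (ChevetIndex m n)) := by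
  set F : (Fin m × Fin n → ℝ) → ℝ :=
    fun y => opNormLpLq p q (Matrix.of fun i j => a i * b j * y (i, j))
  have hF : Continuous F := (continuous_opNormLpLq hp hq).comp (by fun_prop)
  have h1 := (hind.hasLaw_pi fun ij => hg ij.1 ij.2).integral_comp hF.aestronglyMeasurable
  have h2 := (((iIndepFun_eval_stdGauss (ChevetIndex m n)).precomp
    (Sum.inl_injective : Function.Injective (Sum.inl : Fin m × Fin n → ChevetIndex m n))).hasLaw_pi
      fun ij => hasLaw_eval_stdGauss _).integral_comp hF.aestronglyMeasurable
  exact h1.trans h2.symm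

/-- The two-sided bound in terms of the norms of the factors, in all four cases at once. -/
theorem exists_twoSided_opNormLpLq :
    ∃ C : ℝ, 0 < C ∧ ∀ (m n : ℕ) (a : Fin m → ℝ) (b : Fin n → ℝ) (p q ps qs : ℝ≥0∞),
      ps.HolderConjugate p → q.HolderConjugate qs →
        TwoSided C (∫ x, opNormLpLq p q (tensorMatrix a b x) ∂(stdGauss (ChevetIndex m n)))
          (diagNorm qs a * gaussSeqNorm ps b + gaussSeqNorm q a * diagNorm p b) := by
  set U := splitUpper + 8 * gaussExp
  set l := min splitLower (gaussTail * Real.exp (-1))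
  have hG := one_le_gaussExp
  have hU : 0 < U := by
    have : 0 < splitUpper := by unfold splitUpper; positivity
    positivity
  have hl : 0 < l := lt_min splitLower_pos (mul_pos gaussTail_pos (Real.exp_pos _))
  -- `8 * U` comes from `chevet_upper`; `4 / l` comes from adding the two lower bounds, each with
  -- constant `2`.
  refine ⟨max (8 * U) (4 / l), lt_max_of_lt_left (by positivity), ?_⟩
  intro m n a b p q ps qs hps hqs
  have hps1 : 1 ≤ ps := ENNReal.HolderConjugate.one_le ps p
  have hq1 : 1 ≤ q := ENNReal.HolderConjugate.one_le q qs
  have hx := iIndepFun_eval_stdGauss (ChevetIndex m n)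
  have lawA : ∀ i : Fin m, HasLaw (fun x : ChevetIndex m n → ℝ => x (.inr (.inl i)))
      (gaussianReal 0 1) (stdGauss (ChevetIndex m n)) := fun i => hasLaw_eval_stdGauss _
  have lawB : ∀ j : Fin n, HasLaw (fun x : ChevetIndex m n → ℝ => x (.inr (.inr j)))
      (gaussianReal 0 1) (stdGauss (ChevetIndex m n)) := fun i => hasLaw_eval_stdGauss _
  have indA : iIndepFun (fun (i : Fin m) (x : ChevetIndex m n → ℝ) => x (.inr (.inl i)))
      (stdGauss (ChevetIndex m n)) :=
    hx.precomp (Sum.inr_injective.comp Sum.inl_injective)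
  have indB : iIndepFun (fun (j : Fin n) (x : ChevetIndex m n → ℝ) => x (.inr (.inr j)))
      (stdGauss (ChevetIndex m n)) :=
    hx.precomp (Sum.inr_injective.comp Sum.inr_injective)
  have uA := integral_ellNorm_le_gaussSeqNorm lawA hq1 a
  have uB := integral_ellNorm_le_gaussSeqNorm lawB hps1 b
  have lA := gaussSeqNorm_le_integral_ellNorm lawA indA hq1 a
  have lB := gaussSeqNorm_le_integral_ellNorm lawB indB hps1 b
  have cu := chevet_upper a b hps hqs
  have cl := chevet_lower_left a b hps hqs
  have cr := chevet_lower_right a b hps hqs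
  have hσ0 : 0 ≤ diagNorm qs a := diagNorm_nonneg a
  have hτ0 : 0 ≤ diagNorm p b := diagNorm_nonneg b
  have pA : 0 ≤ gaussSeqNorm q a := by
    have h0 : 0 ≤ U * gaussSeqNorm q a :=
      (integral_nonneg fun x => ellNorm_nonneg hq1 _).trans uA
    exact nonneg_of_mul_nonneg_right h0 hU
  have pB : 0 ≤ gaussSeqNorm ps b := by
    have h0 : 0 ≤ U * gaussSeqNorm ps b :=
      (integral_nonneg fun x => ellNorm_nonneg hps1 _).trans uB
    exact nonneg_of_mul_nonneg_right h0 hU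
  set E := ∫ x, opNormLpLq p q (tensorMatrix a b x) ∂(stdGauss (ChevetIndex m n))
  have hR : 0 ≤ diagNorm qs a * gaussSeqNorm ps b + gaussSeqNorm q a * diagNorm p b := by
    positivity
  have hup : E ≤ 8 * U * (diagNorm qs a * gaussSeqNorm ps b + gaussSeqNorm q a * diagNorm p b) := by
    have h1 := mul_le_mul_of_nonneg_left uA hτ0
    have h2 := mul_le_mul_of_nonneg_left uB hσ0
    nlinarith
  have hlow : l * (diagNorm qs a * gaussSeqNorm ps b + gaussSeqNorm q a * diagNorm p b) ≤ 4 * E := by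
    have h1 := mul_le_mul_of_nonneg_left lA hτ0
    have h2 := mul_le_mul_of_nonneg_left lB hσ0
    nlinarith
  refine ⟨?_, hup.trans (mul_le_mul_of_nonneg_right (le_max_left _ _) hR)⟩
  rw [inv_mul_le_iff₀ (lt_max_of_lt_left (by positivity))]
  have hE : 0 ≤ E := by
    have := mul_nonneg hl.le hR
    linarith
  refine le_trans ?_ (mul_le_mul_of_nonneg_right (le_max_right _ _) hE)
  rw [div_mul_eq_mul_div, le_div_iff₀ hl]
  linarith

/-- Compare `ρ⁻¹ + r⁻¹ = 1` with `2⁻¹ + 2⁻¹ = 1`. -/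
theorem le_two_iff_two_le {ρ r : ℝ≥0∞} (h : ρ.HolderConjugate r) : ρ ≤ 2 ↔ 2 ≤ r := by
  rw [← ENNReal.inv_le_inv, ← ENNReal.inv_le_inv (b := 2)]
  have e := ENNReal.HolderConjugate.inv_add_inv_eq_one ρ r
  have e2 := ENNReal.inv_two_add_inv_two
  constructor <;> intro h1 <;> by_contra! h2
  · have := ENNReal.add_lt_add_of_le_of_lt (by simp) h1 h2
    rw [e, e2] at this
    exact lt_irrefl _ this
  · have := ENNReal.add_lt_add_of_lt_of_le (ne_top_of_le_ne_top (by simp) h1) h2 h1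
    rw [e, e2] at this
    exact lt_irrefl _ this

end Assembly

theorem theorem3p1 :
    ∃ C : ℝ, 0 < C ∧
      ∀ (m n : ℕ) (a : Fin m → ℝ) (b : Fin n → ℝ) (p q ps qs : ℝ≥0∞),
        1 ≤ p → 1 ≤ q → ps = p.conjExponent → qs = q.conjExponent →
        ∀ (Ω : Type*) [MeasurableSpace Ω] (P : Measure Ω) [IsProbabilityMeasure P]
          (g : Fin m → Fin n → Ω → ℝ),
          (∀ i j, HasLaw (g i j) (gaussianReal 0 1) P) →
          iIndepFun (fun ij : Fin m × Fin n => g ij.1 ij.2) P →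
          ∀ N : Ω → ℝ,
            N = (fun ω => opNormLpLq p q (Matrix.of fun i j => a i * b j * g i j ω)) →
            Integrable N P ∧
            (ps < 2 → q < 2 →
              TwoSided C (∫ ω, N ω ∂P)
                (ellNorm (twoExp qs) a * ellNorm ps b + ellNorm q a * ellNorm (twoExp p) b)) ∧
            (2 ≤ ps → q < 2 →
              TwoSided C (∫ ω, N ω ∂P)
                (ellNorm (twoExp qs) a * splitNorm ps b + ellNorm q a * ellNorm ∞ b)) ∧
            (ps < 2 → 2 ≤ q →
              TwoSided C (∫ ω, N ω ∂P)
                (ellNorm ∞ a * ellNorm ps b + splitNorm q a * ellNorm (twoExp p) b)) ∧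
            (2 ≤ ps → 2 ≤ q →
              TwoSided C (∫ ω, N ω ∂P)
                (ellNorm ∞ a * splitNorm ps b + splitNorm q a * ellNorm ∞ b)) := by
  obtain ⟨C, hC, H⟩ := exists_twoSided_opNormLpLq
  refine ⟨C, hC, fun m n a b p q ps qs hp hq hps hqs Ω _ P _ g hg hind N hN => ?_⟩
  have hcp : p.HolderConjugate ps := hps ▸ .conjExponent hp
  have hcq : q.HolderConjugate qs := hqs ▸ .conjExponent hq
  have hT := H m n a b p q ps qs hcp.symm hcq
  have hint : Integrable N P := by
    rw [hN]
    exact integrable_opNormLpLq hp hq fun i j =>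
      (integrable_comp_of_hasLaw_gaussian (hg i j) integrable_id_gaussian).const_mul _
  have hE : ∫ ω, N ω ∂P =
      ∫ x, opNormLpLq p q (tensorMatrix a b x) ∂(stdGauss (ChevetIndex m n)) := by
    rw [hN]
    exact integral_tensor_eq hp hq a b hg hind
  rw [← hE] at hT
  -- `diagNorm` splits at `p ≤ 2` and `gaussSeqNorm` at `ps < 2`. Conjugation identifies the two
  -- thresholds, endpoint included, so the four regimes just unfold these definitions.
  have dp1 : ps < 2 → diagNorm p b = ellNorm (twoExp p) b := fun h =>
    if_neg fun h' => not_le.2 h ((le_two_iff_two_le hcp).1 h')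
  have dp2 : 2 ≤ ps → diagNorm p b = ellNorm ∞ b := fun h =>
    if_pos ((le_two_iff_two_le hcp).2 h)
  have dq1 : q < 2 → diagNorm qs a = ellNorm (twoExp qs) a := fun h =>
    if_neg fun h' => not_le.2 h ((le_two_iff_two_le hcq.symm).1 h')
  have dq2 : 2 ≤ q → diagNorm qs a = ellNorm ∞ a := fun h =>
    if_pos ((le_two_iff_two_le hcq.symm).2 h)
  have gp1 : ps < 2 → gaussSeqNorm ps b = ellNorm ps b := fun h => if_pos h
  have gp2 : 2 ≤ ps → gaussSeqNorm ps b = splitNorm ps b := fun h => if_neg (not_lt.2 h)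
  have gq1 : q < 2 → gaussSeqNorm q a = ellNorm q a := fun h => if_pos h
  have gq2 : 2 ≤ q → gaussSeqNorm q a = splitNorm q a := fun h => if_neg (not_lt.2 h)
  refine ⟨hint, fun h1 h2 => ?_, fun h1 h2 => ?_, fun h1 h2 => ?_, fun h1 h2 => ?_⟩
  · rwa [dp1 h1, gp1 h1, dq1 h2, gq1 h2] at hT
  · rwa [dp2 h1, gp2 h1, dq1 h2, gq1 h2] at hT
  · rwa [dp1 h1, gp1 h1, dq2 h2, gq2 h2] at hT
  · rwa [dp2 h1, gp2 h1, dq2 h2, gq2 h2] at hT
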